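/- Let $\mathcal R$ be a one-dimensional fusion rule: there are finitely many prototiles (labelled closed intervals of positive length), finitely many types $P_n(1),\dots,P_n(j_n)$ of $n$-supertiles for each $n\ge 0$, the $0$-supertiles being the prototiles, and each $(n+1)$-supertile is a nonempty concatenation of translates of $n$-supertiles. Let $X^n_{\mathcal R}$ be the space of tilings of $\mathbb R$ by $n$-supertiles all of whose patches occur inside some supertile, with the big ball topology (two tilings are $\varepsilon$-close if, after translations by at most $\varepsilon$, they agree on the ball of radius $1/\varepsilon$ around the origin), let $X_{\mathcal R}=X^0_{\mathcal R}$, on which $\mathbb R$ acts by translation, and assume $X_{\mathcal R}\neq\emptyset$. For $n<N$ let $M_{n,N}(i,l)$ be the number of $n$-supertiles of type $i$ in the $N$-supertile of type $l$. Suppose that 1. (primitive) for each $n$ there is $N>n$ such that all entries of $M_{n,N}$ are positive; 2. (recognizable) for each $n\ge1$ the subdivision map $X^{n}_{\mathcal R}\to X^{n-1}_{\mathcal R}$ is a homeomorphism; 3. (prototile-regular) $j_n=j_0$ for all $n$; 4. (constant length) for each $n$, all $n$-supertiles have the same length $\ell_n$; 5. (coincident with finite waiting) there is a fixed integer $k\ge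 0$ such that, for each $n$, any two $(n+k)$-supertiles, laid over each other, have at least one $n$-supertile in common, of the same type and in the same place; 6. the entries of the transition matrices $M_{n-1,n}$, $n\ge1$, are bounded by a constant that does not depend on $n$. Then $X_{\mathcal R}$ is uniquely ergodic, that is, there is exactly one translation-invariant Borel probability measure $\mu$ on $X_{\mathcal R}$, and it has pure point spectrum: the span of the measurable eigenfunctions is dense in $L^2(X_{\mathcal R},\mu)$, where an eigenfunction is a measurable $f:X_{\mathcal R}\to\{z\in\mathbb C:|z|=1\}$ with $f(\mathbf T-v)=e^{2\pi i\alpha v}f(\mathbf T)$ for some $\alpha\in\mathbb R$ and all $v\in\mathbb R$, $\mathbf T\in X_{\mathcal R}$. Moreover, let $L_n=\ell_n/\ell_{n-1}$ be the number of $(n-1)$-supertiles in an $n$-supertile, and let $S_{\mathcal R}$ be the solenoid $\{(z_n)_{n\ge0}\in(\mathbb R/\mathbb Z)^{\mathbb N}: L_{n+1}z_{n+1}=z_n \text{ for all } n\}$, on which $v\in\mathbb R$ acts by $z_n\mapsto z_n+v/\ell_n$. Then the map $\pi:X_{\mathcal R}\to S_{\mathcal R}$ whose $n$-th coordinate is $-x/\ell_n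 \bmod 1$, where $x$ is the left endpoint of any $n$-supertile of $\mathbf T$, is continuous and is a measurable conjugacy: it intertwines the two actions, it maps $\mu$ to Haar measure on $S_{\mathcal R}$, and it is injective on a measurable set of full $\mu$-measure. -/

import Mathlib

open MeasureTheory

noncomputable section

/-- A one-dimensional fusion rule. At level `n` there are `j n` species of `n`-supertiles.
The `0`-supertiles are the prototiles, labelled closed intervals of positive length `len p`, and
the `(n+1)`-supertile `i` is the concatenation, from left to right, of the `n`-supertiles listed
in the nonempty word `word n i`. Copies are translates. -/
structure FusionRule where
  j : ℕ → ℕ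
  len : Fin (j 0) → ℝ
  len_pos : ∀ p, 0 < len p
  word : ∀ n, Fin (j (n + 1)) → List (Fin (j n))
  word_ne_nil : ∀ n i, word n i ≠ []

/-- Lay the tiles of a word side by side, starting at the point `x`. A tile is a pair `(y, p)`:
a tile of type `p`, of length `ℓ p`, with left endpoint `y`. -/
def placeWord {α : Type} (ℓ : α → ℝ) : ℝ → List α → List (ℝ × α)
  | _, [] => []
  | x, p :: w => (x, p) :: placeWord ℓ (x + ℓ p) w

theorem mem_placeWord_add {α : Type} (ℓ : α → ℝ) (v : ℝ) (w : List α) :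
    ∀ (x : ℝ) (t : ℝ × α), t ∈ placeWord ℓ (x + v) w → (t.1 - v, t.2) ∈ placeWord ℓ x w := by
  induction w with
  | nil => intro x t h; simp [placeWord] at h
  | cons p w ih =>
    intro x t h
    simp only [placeWord, List.mem_cons] at h ⊢
    rcases h with rfl | h
    · left; simp
    · right
      apply ih
      rwa [show x + ℓ p + v = x + v + ℓ p by ring]

namespace FusionRule

variable (R : FusionRule)

/-- The length of the `n`-supertile of type `i`. -/
def size : ∀ n, Fin (R.j n) → ℝ
  | 0 => R.len
  | n + 1 => fun i => ((R.word n i).map (size n)).sum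

/-- The `(n+k)`-supertile of type `i`, written as a word of `n`-supertiles. -/
def expand (n : ℕ) : ∀ k, Fin (R.j (n + k)) → List (Fin (R.j n))
  | 0 => fun i => [i]
  | k + 1 => fun i => (R.word (n + k) i).flatMap (expand n k)

/-- The transition matrix from level `n` to level `n + k`: its `(i, l)` entry is the number of
`n`-supertiles of type `i` in the `(n+k)`-supertile of type `l`. -/
def transition (n k : ℕ) : Matrix (Fin (R.j n)) (Fin (R.j (n + k))) ℕ :=
  fun i l => (R.expand n k l).count i

/-- A patch of `n`-supertiles is admitted if a copy of it is found inside some supertile. (A finite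
union of intervals overlapping only at endpoints, with connected union, is a word up to
translation.) -/
def Admitted (n : ℕ) (w : List (Fin (R.j n))) : Prop :=
  ∃ k i, w <:+: R.expand n k i

/-- The interval covered by a tile of level `n`. -/
def support (n : ℕ) (t : ℝ × Fin (R.j n)) : Set ℝ :=
  Set.Icc t.1 (t.1 + R.size n t.2)

/-- The space of fusion tilings of the line in which the `n`-supertiles are considered the smallest
building blocks: the tiles cover the line, overlap only on their boundaries, and every patch
contained in the tiling is admitted. For `n = 0` this is the tiling space of the fusion rule. -/
@[ext] structure TilingSpace (n : ℕ) where
  tiles : Set (ℝ × Fin (R.j n))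
  covers : ∀ x : ℝ, ∃ t ∈ tiles, x ∈ R.support n t
  nonoverlapping : ∀ s ∈ tiles, ∀ t ∈ tiles, s ≠ t →
    Disjoint (interior (R.support n s)) (interior (R.support n t))
  admitted : ∀ (x : ℝ) (w : List (Fin (R.j n))),
    (∀ t ∈ placeWord (R.size n) x w, t ∈ tiles) → R.Admitted n w

variable {R}

/-- The translated tiling `T - v`. -/
def TilingSpace.translate {n : ℕ} (v : ℝ) (T : R.TilingSpace n) : R.TilingSpace n where
  tiles := {t | (t.1 + v, t.2) ∈ T.tiles}
  covers x := by
    obtain ⟨t, ht, hx⟩ := T.covers (x + v)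
    refine ⟨(t.1 - v, t.2), by simpa using ht, ?_⟩
    simp only [support, Set.mem_Icc] at hx ⊢
    constructor <;> linarith [hx.1, hx.2]
  nonoverlapping s hs t ht hst := by
    have hne : ((s.1 + v, s.2) : ℝ × Fin (R.j n)) ≠ (t.1 + v, t.2) := by
      intro h
      apply hst
      rw [Prod.mk.injEq] at h
      exact Prod.ext (by linarith [h.1]) h.2
    have h := T.nonoverlapping _ hs _ ht hne
    simp only [support, interior_Icc] at h ⊢
    rw [Set.disjoint_left] at h ⊢
    intro x hxs hxt
    refine h (a := x + v) ?_ ?_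
    · constructor <;> linarith [hxs.1, hxs.2]
    · constructor <;> linarith [hxt.1, hxt.2]
  admitted x w h := by
    refine T.admitted (x + v) w fun t ht => ?_
    have := h _ (mem_placeWord_add (R.size n) v w x t ht)
    simpa using this

/-- Two tilings are `ε`-close if, after translations by at most `ε`, they have the same tiles
meeting the ball of radius `1/ε` around the origin. -/
def TilingSpace.Close {n : ℕ} (ε : ℝ) (T T' : R.TilingSpace n) : Prop :=
  ∃ g g' : ℝ, |g| ≤ ε ∧ |g'| ≤ ε ∧ ∀ t : ℝ × Fin (R.j n),
    (R.support n t ∩ Metric.closedBall 0 (1 / ε)).Nonempty →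
      (t ∈ (T.translate g).tiles ↔ t ∈ (T'.translate g').tiles)

theorem TilingSpace.Close.mono {n : ℕ} {ε δ : ℝ} (hε : 0 < ε) (h : ε ≤ δ)
    {T T' : R.TilingSpace n} (hc : TilingSpace.Close ε T T') : TilingSpace.Close δ T T' := by
  obtain ⟨g, g', hg, hg', ht⟩ := hc
  refine ⟨g, g', hg.trans h, hg'.trans h, fun t hm => ht t (hm.mono ?_)⟩
  exact Set.inter_subset_inter_right _
    (Metric.closedBall_subset_closedBall (one_div_le_one_div_of_le hε h))

/-- The big ball topology. -/
instance (n : ℕ) : TopologicalSpace (R.TilingSpace n) where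
  IsOpen U := ∀ T ∈ U, ∃ ε > 0, ∀ T', TilingSpace.Close ε T T' → T' ∈ U
  isOpen_univ _ _ := ⟨1, one_pos, fun _ _ => trivial⟩
  isOpen_inter U V hU hV T hT := by
    obtain ⟨ε, hε, h⟩ := hU T hT.1
    obtain ⟨δ, hδ, h'⟩ := hV T hT.2
    have hm : 0 < min ε δ := lt_min hε hδ
    exact ⟨min ε δ, hm, fun T' hc =>
      ⟨h T' (hc.mono hm (min_le_left _ _)), h' T' (hc.mono hm (min_le_right _ _))⟩⟩
  isOpen_sUnion 𝒰 h𝒰 T hT := by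
    obtain ⟨U, hU, hTU⟩ := hT
    obtain ⟨ε, hε, h⟩ := h𝒰 U hU T hTU
    exact ⟨ε, hε, fun T' hc => ⟨U, hU, h T' hc⟩⟩

instance (n : ℕ) : MeasurableSpace (R.TilingSpace n) := borel _

instance (n : ℕ) : BorelSpace (R.TilingSpace n) := ⟨rfl⟩

variable (R)

/-- Break every `(n+1)`-supertile of a collection into its `n`-supertiles. -/
def subdivide (n : ℕ) (S : Set (ℝ × Fin (R.j (n + 1)))) : Set (ℝ × Fin (R.j n)) :=
  {t | ∃ s ∈ S, t ∈ placeWord (R.size n) s.1 (R.word n s.2)}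

/-- Break every `n`-supertile of a collection all the way down into prototiles. -/
def subdivideAll : ∀ n, Set (ℝ × Fin (R.j n)) → Set (ℝ × Fin (R.j 0))
  | 0 => fun S => S
  | n + 1 => fun S => subdivideAll n (R.subdivide n S)

/-- Each `n`-supertile is contained in all `N`-supertiles, for some `N > n`. -/
def Primitive : Prop :=
  ∀ n, ∃ k > 0, ∀ i l, 0 < R.transition n k i l

/-- Each subdivision map, from tilings by `(n+1)`-supertiles to tilings by `n`-supertiles, is a
homeomorphism. -/
def Recognizable : Prop :=
  ∀ n, ∃ h : R.TilingSpace (n + 1) ≃ₜ R.TilingSpace n,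
    ∀ T, (h T).tiles = R.subdivide n T.tiles

/-- The number of supertiles is the same at each level. -/
def PrototileRegular : Prop :=
  ∀ n, R.j n = R.j 0

/-- At each level, all supertiles have the same size. -/
def ConstantLength : Prop :=
  ∀ n i l, R.size n i = R.size n l

/-- There is a fixed `k` such that, for each `n`, any two `(n+k)`-supertiles, laid over each other,
have at least one `n`-supertile in common, of the same type and in the same place. -/
def CoincidentWithFiniteWaiting : Prop :=
  ∃ k, ∀ n, ∀ i l : Fin (R.j (n + k)), ∃ (m : ℕ) (p : Fin (R.j n)),
    (R.expand n k i)[m]? = some p ∧ (R.expand n k l)[m]? = some p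

/-- The one-step transition matrices have entries bounded by a common constant. -/
def UniformlyBoundedTransitions : Prop :=
  ∃ C, ∀ n i l, R.transition n 1 i l ≤ C

variable {R}

/-- Borel probability measures on the tiling space that are invariant under translation. -/
structure IsInvariantProbability (μ : Measure (R.TilingSpace 0)) : Prop where
  isProbability : IsProbabilityMeasure μ
  invariant : ∀ v : ℝ, MeasurePreserving (TilingSpace.translate v) μ μ

variable (R) in
/-- There is exactly one translation-invariant Borel probability measure. -/
def UniquelyErgodic : Prop :=
  ∃! μ : Measure (R.TilingSpace 0), IsInvariantProbability μ

/-- `f` is a measurable eigenfunction of the translation action with eigenvalue `α`. -/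
structure IsEigenfunction (α : ℝ) (f : R.TilingSpace 0 → ℂ) : Prop where
  measurable : Measurable f
  norm_eq_one : ∀ T, ‖f T‖ = 1
  eigen : ∀ (v : ℝ) T,
    f (T.translate v) = Complex.exp (2 * Real.pi * Complex.I * α * v) * f T

/-- The span of the eigenfunctions is dense in `L²`. -/
def HasPurePointSpectrum (μ : Measure (R.TilingSpace 0)) : Prop :=
  Dense (Submodule.span ℂ {F : Lp ℂ 2 μ | ∃ α f, IsEigenfunction α f ∧ F =ᵐ[μ] f} :
    Set (Lp ℂ 2 μ))

variable (R) in
/-- The solenoid of a fusion rule of constant length: the inverse limit of the circle `ℝ/ℤ` under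
the multiplications by the number of `n`-supertiles in an `(n+1)`-supertile. -/
def solenoid : AddSubgroup (ℕ → UnitAddCircle) where
  carrier := {z | ∀ n i, (R.word n i).length • z (n + 1) = z n}
  zero_mem' := by intro n i; simp
  add_mem' := by
    intro a b ha hb n i
    rw [Pi.add_apply, Pi.add_apply, nsmul_add, ha n i, hb n i]
  neg_mem' := by
    intro a ha n i
    rw [Pi.neg_apply, Pi.neg_apply, smul_neg, ha n i]

/-- `π` is the map to the solenoid that records, for each `n`, where the origin lies in its
`n`-supertile: if `(x, p)` is a supertile of a tiling `S` by `n`-supertiles that subdivides to `T`,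
then the `n`-th coordinate of `π T` is the offset `0 - x` in units of the size of the supertile. -/
def IsSolenoidMap (π : R.TilingSpace 0 → R.solenoid) : Prop :=
  ∀ (T : R.TilingSpace 0) (n : ℕ) (S : R.TilingSpace n), R.subdivideAll n S.tiles = T.tiles →
    ∀ s ∈ S.tiles, (π T : ℕ → UnitAddCircle) n = ((-s.1 / R.size n s.2 : ℝ) : UnitAddCircle)

/-- `π` is a measurable conjugacy from the tiling space with `μ` to the solenoid with its Haar
measure, on which `v` acts by adding `v / size` to each coordinate. -/
structure IsMeasurableConjugacy (μ : Measure (R.TilingSpace 0))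
    (π : R.TilingSpace 0 → R.solenoid) : Prop where
  measurable : Measurable π
  equivariant : ∀ (v : ℝ) T n i, (π (T.translate v) : ℕ → UnitAddCircle) n =
    (π T : ℕ → UnitAddCircle) n + ((v / R.size n i : ℝ) : UnitAddCircle)
  haar : (μ.map π).IsAddHaarMeasure
  injective : ∃ Y, MeasurableSet Y ∧ μ Yᶜ = 0 ∧ Set.InjOn π Y

end FusionRule

end

/-! Stack all `N`-supertiles over one another and look at their `n`-supertiles. The theorem rests on
one fact: for fixed `n` and large `N`, the proportion of positions at which the types fail to show a
common `n`-supertile is as small as desired. Pairwise coincidence is first upgraded to a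
simultaneous coincidence of all types within a number `Q` of positions that does not depend on the
level (`exists_coincidence_finset`). This uses that the number of types and the lengths of one-step
words are bounded. Non-coincident positions are submultiplicative under composition
(`card_noncoincident_comp_le`), so each further stage multiplies their density by a factor at most
`1 - 1/(Q+1)` (`exists_card_noncoincident_le`).

Consequently, for most values of a single coordinate of `π T`, that coordinate alone fixes `T` on a
given ball: the ball lies inside an `n`-supertile which is the same in every `N`-supertile
(`exists_isOpen_agree`). Let the determined set be the set of solenoid points for which every ball
is fixed in this way by some coordinate. Over it `π` is injective; every point of it has a preimage,
a limit of translates of one tiling; and the inverse there is continuous, which gives a measurable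
`σ` with `π (σ z) = z` on that set.

A flow-invariant probability on the solenoid has Lebesgue marginals, since `ℝ` acts transitively on
each coordinate circle. It is therefore unique, equals Haar measure, and gives the determined set
full mass. So any invariant `μ` must be the image of Haar measure under `σ`, and that image is
invariant. The spectrum carries over from the solenoid, where Stone–Weierstrass applies to the
continuous eigenfunctions. -/

noncomputable section

/-! ### Words and their layout as tiles. -/

section PlaceWord

variable {α β : Type}

theorem placeWord_append (ℓ : α → ℝ) (u v : List α) (x : ℝ) :
    placeWord ℓ x (u ++ v) = placeWord ℓ x u ++ placeWord ℓ (x + (u.map ℓ).sum) v := by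
  induction u generalizing x with
  | nil => simp [placeWord]
  | cons a u ih => simp [placeWord, ih, add_assoc]

theorem mem_placeWord_flatMap {ℓ : α → ℝ} {m : β → ℝ} {f : β → List α}
    (hf : ∀ b, ((f b).map ℓ).sum = m b) (w : List β) (x : ℝ) (t : ℝ × α) :
    t ∈ placeWord ℓ x (w.flatMap f) ↔
      ∃ s ∈ placeWord m x w, t ∈ placeWord ℓ s.1 (f s.2) := by
  induction w generalizing x with
  | nil => simp [placeWord]
  | cons b w ih => simp [placeWord, placeWord_append, ih, hf]

theorem exists_mem_placeWord {ℓ : α → ℝ} (w : List α) {x y : ℝ} (hx : x ≤ y)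
    (hy : y < x + (w.map ℓ).sum) : ∃ t ∈ placeWord ℓ x w, t.1 ≤ y ∧ y < t.1 + ℓ t.2 := by
  induction w generalizing x with
  | nil => simp at hy; linarith
  | cons a w ih =>
    simp only [List.map_cons, List.sum_cons] at hy
    rcases lt_or_ge y (x + ℓ a) with h | h
    · exact ⟨(x, a), by simp [placeWord], hx, h⟩
    · obtain ⟨t, ht, h'⟩ := ih h (by linarith)
      exact ⟨t, by simp [placeWord, ht], h'⟩

theorem mem_placeWord_of_getElem? {ℓ : α → ℝ} {c : ℝ} (hc : ∀ a, ℓ a = c) {w : List α} {i : ℕ}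
    {p : α} (x : ℝ) (h : w[i]? = some p) : (x + i * c, p) ∈ placeWord ℓ x w := by
  induction w generalizing x i with
  | nil => simp at h
  | cons a w ih =>
    cases i with
    | zero => simp at h; simp [placeWord, h]
    | succ i =>
      simp only [List.getElem?_cons_succ] at h
      have := ih (x + ℓ a) h
      rw [hc a] at this
      simp only [placeWord, List.mem_cons, hc a]
      right
      convert this using 2
      push_cast; ring

theorem getElem?_flatMap_of_length {f : β → List α} {L : ℕ} (hL : ∀ b, (f b).length = L)
    {w : List β} {i i' : ℕ} {b : β} (h : w[i]? = some b) (hi' : i' < L) :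
    (w.flatMap f)[i * L + i']? = (f b)[i']? := by
  induction w generalizing i with
  | nil => simp at h
  | cons a w ih =>
    cases i with
    | zero =>
      simp at h
      subst h
      simp [List.getElem?_append, hL, hi']
    | succ i =>
      simp only [List.getElem?_cons_succ] at h
      rw [List.flatMap_cons, List.getElem?_append_right (by rw [hL]; nlinarith), hL, ← ih h]
      congr 1
      rw [Nat.succ_mul]; omega

theorem length_flatMap_of_length {f : β → List α} {L : ℕ} (hL : ∀ b, (f b).length = L)
    (w : List β) : (w.flatMap f).length = w.length * L := by
  simp [List.length_flatMap, hL]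

end PlaceWord

/-! ### Expansion of supertiles into words of lower level. -/

namespace FusionRule

variable {R : FusionRule}

/-- `W` writes each `N`-supertile as a word of `n`-supertiles. -/
inductive IsExpansion (R : FusionRule) (n : ℕ) :
    ∀ N : ℕ, (Fin (R.j N) → List (Fin (R.j n))) → Prop
  | refl : IsExpansion R n n fun i => [i]
  | step {N : ℕ} {W : Fin (R.j N) → List (Fin (R.j n))} : IsExpansion R n N W →
      IsExpansion R n (N + 1) fun i => (R.word N i).flatMap W

variable (R) in
/-- The `n`-supertile of type `i`, written as a word of prototiles. -/
def down : ∀ n, Fin (R.j n) → List (Fin (R.j 0))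
  | 0 => fun i => [i]
  | n + 1 => fun i => (R.word n i).flatMap (down n)

theorem isExpansion_expand (n k : ℕ) : R.IsExpansion n (n + k) (R.expand n k) := by
  induction k with
  | zero => exact .refl
  | succ k ih => exact .step ih

/-- Composition is stated for the relation `IsExpansion` rather than for `expand`, so that the
levels `(n + k) + l` and `n + (k + l)` never have to be identified. -/
theorem IsExpansion.comp {n N M : ℕ} {W : Fin (R.j N) → List (Fin (R.j n))}
    {V : Fin (R.j M) → List (Fin (R.j N))} (hW : R.IsExpansion n N W) (hV : R.IsExpansion N M V) :
    R.IsExpansion n M fun q => (V q).flatMap W := by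
  induction hV with
  | refl => simpa using hW
  | step _ ih => simpa [List.flatMap_assoc] using IsExpansion.step ih

theorem IsExpansion.down_eq {n N : ℕ} {W : Fin (R.j N) → List (Fin (R.j n))}
    (hW : R.IsExpansion n N W) (q : Fin (R.j N)) : R.down N q = (W q).flatMap (R.down n) := by
  induction hW with
  | refl => simp
  | step _ ih =>
    simp only [down, List.flatMap_assoc]
    congr 1
    exact funext ih

theorem sum_map_size_down (n : ℕ) (i : Fin (R.j n)) :
    ((R.down n i).map (R.size 0)).sum = R.size n i := by
  induction n with
  | zero => simp [down]
  | succ n ih =>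
    change (((R.word n i).flatMap (R.down n)).map (R.size 0)).sum =
      ((R.word n i).map (R.size n)).sum
    induction R.word n i with
    | nil => simp
    | cons a w ih' =>
      rw [List.flatMap_cons, List.map_append, List.sum_append, List.map_cons, List.sum_cons, ih, ih']

theorem size_pos (n : ℕ) (i : Fin (R.j n)) : 0 < R.size n i := by
  induction n with
  | zero => exact R.len_pos i
  | succ n ih =>
    refine List.sum_pos _ ?_ ?_
    · simp only [List.mem_map]
      rintro _ ⟨a, -, rfl⟩
      exact ih a
    · simpa using R.word_ne_nil n i

/-! ### Lengths, coincidences and their density. -/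

section Size

variable {ℓ : ℕ → ℝ}

theorem IsExpansion.length_mul (hℓ : ∀ n i, R.size n i = ℓ n) {n N : ℕ}
    {W : Fin (R.j N) → List (Fin (R.j n))} (hW : R.IsExpansion n N W) (q : Fin (R.j N)) :
    (W q).length * ℓ n = ℓ N := by
  induction hW with
  | refl => simp
  | @step N W _ ih =>
    rw [← hℓ (N + 1) q]
    simp only [size]
    induction R.word N q with
    | nil => simp
    | cons a w ih' =>
      rw [List.flatMap_cons, List.length_append, List.map_cons, List.sum_cons, ← ih', hℓ, ← ih a]
      push_cast
      ring

theorem word_length_mul (hℓ : ∀ n i, R.size n i = ℓ n) (n : ℕ) (q : Fin (R.j (n + 1))) :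
    (R.word n q).length * ℓ n = ℓ (n + 1) := by
  simpa using (IsExpansion.step IsExpansion.refl).length_mul hℓ q

theorem IsExpansion.length_eq (hℓ : ∀ n i, R.size n i = ℓ n) {n N : ℕ}
    {W : Fin (R.j N) → List (Fin (R.j n))} (hW : R.IsExpansion n N W) (hn : 0 < ℓ n)
    (q q' : Fin (R.j N)) : (W q).length = (W q').length := by
  have h := (hW.length_mul hℓ q).trans (hW.length_mul hℓ q').symm
  exact_mod_cast mul_right_cancel₀ hn.ne' h

theorem word_length_le {C : ℕ} (hC : ∀ n i l, R.transition n 1 i l ≤ C) (n : ℕ)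
    (q : Fin (R.j (n + 1))) : (R.word n q).length ≤ R.j n * C := by
  have h : (R.word n q).length = ∑ i : Fin (R.j n), (R.word n q).count i := by
    have := Multiset.sum_count_eq_card (s := Finset.univ) (m := Multiset.ofList (R.word n q))
      (fun _ _ => Finset.mem_univ _)
    simpa using this.symm
  rw [h]
  calc ∑ i : Fin (R.j n), (R.word n q).count i ≤ ∑ _i : Fin (R.j n), C :=
        Finset.sum_le_sum fun i _ => by simpa [transition, expand] using hC n i q
    _ = R.j n * C := by simp

theorem length_flatMap_le {α β : Type} {f : β → List α} {B : ℕ} (hB : ∀ b, (f b).length ≤ B)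
    (w : List β) : (w.flatMap f).length ≤ w.length * B := by
  induction w with
  | nil => simp
  | cons a w ih =>
    rw [List.flatMap_cons, List.length_append, List.length_cons, add_mul, one_mul, add_comm]
    exact Nat.add_le_add ih (hB a)

theorem expand_length_le {B : ℕ} (hB : ∀ n q, (R.word n q).length ≤ B) (n k : ℕ)
    (q : Fin (R.j (n + k))) : (R.expand n k q).length ≤ B ^ k := by
  induction k with
  | zero => simp [expand]
  | succ k ih =>
    calc _ ≤ (R.word (n + k) q).length * B ^ k := length_flatMap_le ih _
      _ ≤ B * B ^ k := Nat.mul_le_mul_right _ (hB _ _)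
      _ = B ^ (k + 1) := by ring

/-- Induction on the size of the family. Two members share an `N`-supertile at some position, so at
that position the family shows fewer distinct `N`-supertiles than it has members, and the induction
hypothesis applies to these. Each stage costs a factor `B ^ k` in length, so `Q` depends on `m` but
not on `n`. -/
theorem exists_coincidence_finset (hℓ : ∀ n i, R.size n i = ℓ n) (hpos : ∀ n, 0 < ℓ n)
    (hcoin : R.CoincidentWithFiniteWaiting) {B : ℕ} (hB : ∀ n q, (R.word n q).length ≤ B) (m : ℕ) :
    ∃ Q : ℕ, ∀ n, ∃ N, ∃ W : Fin (R.j N) → List (Fin (R.j n)), R.IsExpansion n N W ∧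
      (∀ q, (W q).length ≤ Q) ∧ ∀ A : Finset (Fin (R.j N)), A.Nonempty → A.card ≤ m + 1 →
        ∃ (i : ℕ) (p : Fin (R.j n)), ∀ q ∈ A, (W q)[i]? = some p := by
  classical
  obtain ⟨k, hk⟩ := hcoin
  induction m with
  | zero =>
    refine ⟨1, fun n => ⟨n, _, .refl, fun q => by simp, fun A hA hc => ?_⟩⟩
    obtain ⟨a, rfl⟩ := Finset.card_eq_one.1 (le_antisymm hc hA.card_pos)
    exact ⟨0, a, by simp⟩
  | succ m ih =>
    obtain ⟨Q, hQ⟩ := ih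
    refine ⟨B ^ k * Q, fun n => ?_⟩
    obtain ⟨N, W, hW, hlen, hA⟩ := hQ n
    refine ⟨N + k, _, hW.comp (isExpansion_expand N k), fun q => ?_, fun A hne hc => ?_⟩
    · exact (length_flatMap_le hlen _).trans (Nat.mul_le_mul_right _ (expand_length_le hB _ _ _))
    obtain ⟨a, ha⟩ := hne
    -- A one-element family is allowed, with `b = a`; nothing has to be merged then.
    obtain ⟨b, hb, hab⟩ : ∃ b ∈ A, A.card ≤ 1 ∨ a ≠ b := by
      by_cases h : 1 < A.card
      · obtain ⟨b, hb, hba⟩ := Finset.exists_mem_ne h a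
        exact ⟨b, hb, Or.inr hba.symm⟩
      · exact ⟨a, ha, Or.inl (not_lt.1 h)⟩
    obtain ⟨i, p, hpa, hpb⟩ := hk N a b
    have hi : ∀ q, ∃ c, (R.expand N k q)[i]? = some c := by
      intro q
      have hlt : i < (R.expand N k a).length := (List.getElem?_eq_some_iff.1 hpa).1
      rw [(isExpansion_expand N k).length_eq hℓ (hpos N) a q] at hlt
      exact ⟨_, List.getElem?_eq_getElem hlt⟩
    choose c hc' using hi
    have hcab : c a = c b := by
      have h1 := hc' a
      have h2 := hc' b
      rw [hpa] at h1
      rw [hpb] at h2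
      exact (Option.some.inj h1).symm.trans (Option.some.inj h2)
    have hcard : (A.image c).card ≤ m + 1 := by
      rcases hab with h | h
      · exact Finset.card_image_le.trans (h.trans (by omega))
      · have hsub : A.image c ⊆ (A.erase b).image c := by
          intro y hy
          obtain ⟨x, hx, rfl⟩ := Finset.mem_image.1 hy
          by_cases hxb : x = b
          · subst hxb
            exact Finset.mem_image.2 ⟨a, Finset.mem_erase.2 ⟨h, ha⟩, hcab⟩
          · exact Finset.mem_image_of_mem _ (Finset.mem_erase.2 ⟨hxb, hx⟩)
        have := (Finset.card_le_card hsub).trans Finset.card_image_le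
        rw [Finset.card_erase_of_mem hb] at this
        omega
    obtain ⟨i', p', hp'⟩ := hA (A.image c) ⟨c a, Finset.mem_image_of_mem _ ha⟩ hcard
    refine ⟨i * (W (c a)).length + i', p', fun q hq => ?_⟩
    have hq' := hp' _ (Finset.mem_image_of_mem c hq)
    have hL : ∀ b, (W b).length = (W (c a)).length := fun b => hW.length_eq hℓ (hpos n) _ _
    rw [getElem?_flatMap_of_length hL (hc' q)]
    · exact hq'
    · rw [← hL (c q)]
      exact (List.getElem?_eq_some_iff.1 hq').1

/-- The positions at which the words of a family do not all have the same letter. -/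
def noncoincident {n N : ℕ} (W : Fin (R.j N) → List (Fin (R.j n))) (L : ℕ) : Finset ℕ :=
  by classical exact (Finset.range L).filter fun i => ¬ ∃ p, ∀ q, (W q)[i]? = some p

/-- Write a position as `(i / L, i % L)`: outer letter and place inside it. If all outer letters
agree, everything inside agrees; if all inner words agree at `i % L`, the outer letters do not
matter. A bad position thus has both components bad. -/
theorem card_noncoincident_comp_le {n N M : ℕ} {W : Fin (R.j N) → List (Fin (R.j n))}
    {V : Fin (R.j M) → List (Fin (R.j N))} {L K : ℕ} (hW : ∀ q, (W q).length = L)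
    (hV : ∀ q, (V q).length = K) :
    (noncoincident (fun q => (V q).flatMap W) (K * L)).card ≤
      (noncoincident V K).card * (noncoincident W L).card := by
  classical
  rw [← Finset.card_product]
  refine Finset.card_le_card_of_injOn (fun i => (i / L, i % L)) ?_ ?_
  · intro i hi
    simp only [noncoincident, Finset.coe_filter, Finset.mem_range, Set.mem_ofPred_eq] at hi
    obtain ⟨hi, hn⟩ := hi
    have hL : 0 < L := Nat.pos_of_ne_zero (by rintro rfl; simp at hi)
    have h1 : i / L < K := Nat.div_lt_of_lt_mul (by rwa [mul_comm])
    have h2 : i % L < L := Nat.mod_lt _ hL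
    have h3 : i / L * L + i % L = i := Nat.div_add_mod' i L
    have hget : ∀ q, ((V q).flatMap W)[i]? =
        (W ((V q)[i / L]'(by rw [hV]; exact h1)))[i % L]? := by
      intro q
      conv_lhs => rw [← h3]
      exact getElem?_flatMap_of_length hW (List.getElem?_eq_getElem _) h2
    simp only [Finset.coe_product, Set.mem_prod, noncoincident, Finset.coe_filter,
      Finset.mem_range, Set.mem_ofPred_eq]
    refine ⟨⟨h1, ?_⟩, h2, ?_⟩
    · rintro ⟨p, hp⟩
      have h2' : i % L < (W p).length := by rw [hW]; exact h2
      refine hn ⟨(W p)[i % L], fun q => ?_⟩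
      rw [hget q, (List.getElem?_eq_some_iff.1 (hp q)).2, List.getElem?_eq_getElem h2']
    · rintro ⟨p, hp⟩
      exact hn ⟨p, fun q => by rw [hget q, hp]⟩
  · intro i _ i' _ h
    simp only [Prod.mk.injEq] at h
    rw [← Nat.div_add_mod' i L, ← Nat.div_add_mod' i' L, h.1, h.2]

/-- Stages of at most `Q` letters are composed. Each has a position common to all types, and since
`Q` is the same at every level the density of bad positions decays geometrically. -/
theorem exists_card_noncoincident_le [∀ n, Nonempty (Fin (R.j n))]
    (hℓ : ∀ n i, R.size n i = ℓ n) (hpos : ∀ n, 0 < ℓ n) (hreg : R.PrototileRegular)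
    (hcoin : R.CoincidentWithFiniteWaiting) (hbdd : R.UniformlyBoundedTransitions)
    {ε : ℝ} (hε : 0 < ε) (n : ℕ) :
    ∃ N, ∃ W : Fin (R.j N) → List (Fin (R.j n)), ∃ L : ℕ, R.IsExpansion n N W ∧
      (∀ q, (W q).length = L) ∧ ((noncoincident W L).card : ℝ) ≤ ε * L := by
  classical
  obtain ⟨C, hC⟩ := hbdd
  have hB : ∀ n q, (R.word n q).length ≤ R.j 0 * C := fun n q => by
    exact (word_length_le hC n q).trans_eq (by rw [hreg n])
  obtain ⟨Q, hQ⟩ := exists_coincidence_finset hℓ hpos hcoin hB (R.j 0)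
  -- One good position among `K ≤ Q` leaves at most `K - 1 ≤ c * K` bad ones; `Q + 1` avoids
  -- division by zero.
  set c : ℝ := 1 - 1 / (Q + 1) with hc
  have hQ0 : (0 : ℝ) < Q + 1 := by positivity
  have hc0 : 0 ≤ c := by
    rw [hc, sub_nonneg, div_le_one hQ0]
    linarith [Nat.cast_nonneg (α := ℝ) Q]
  have hc1 : c < 1 := by
    have : (0 : ℝ) < 1 / (Q + 1) := by positivity
    linarith
  have key : ∀ m : ℕ, ∃ N, ∃ W : Fin (R.j N) → List (Fin (R.j n)), ∃ L : ℕ, R.IsExpansion n N W ∧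
      (∀ q, (W q).length = L) ∧ ((noncoincident W L).card : ℝ) ≤ c ^ m * L := by
    intro m
    induction m with
    | zero =>
      refine ⟨n, _, 1, .refl, fun q => by simp, ?_⟩
      have := Finset.card_filter_le (Finset.range 1)
        fun i => ¬ ∃ p, ∀ q : Fin (R.j n), [q][i]? = some p
      simp only [Finset.card_range] at this
      simpa [noncoincident] using this
    | succ m ih =>
      obtain ⟨N, W, L, hW, hL, hcard⟩ := ih
      obtain ⟨M, V, hV, hVQ, hA⟩ := hQ N
      obtain ⟨q₀⟩ := (inferInstance : Nonempty (Fin (R.j M)))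
      have hK : ∀ q, (V q).length = (V q₀).length := fun q => hV.length_eq hℓ (hpos N) _ _
      obtain ⟨i, p, hip⟩ := hA Finset.univ ⟨q₀, Finset.mem_univ _⟩ (by simp [hreg M])
      refine ⟨M, _, (V q₀).length * L, hW.comp hV,
        fun q => by rw [length_flatMap_of_length hL, hK], ?_⟩
      have hi : i < (V q₀).length :=
        (List.getElem?_eq_some_iff.1 (hip q₀ (Finset.mem_univ _))).1
      have hlt : (noncoincident V (V q₀).length).card + 1 ≤ (V q₀).length := by
        have hs : noncoincident V (V q₀).length ⊆ (Finset.range (V q₀).length).erase i := by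
          intro x hx
          simp only [noncoincident, Finset.mem_filter] at hx
          refine Finset.mem_erase.2 ⟨?_, hx.1⟩
          rintro rfl
          exact hx.2 ⟨p, fun q => hip q (Finset.mem_univ _)⟩
        have := Finset.card_le_card hs
        rw [Finset.card_erase_of_mem (Finset.mem_range.2 hi), Finset.card_range] at this
        omega
      have hV' : ((noncoincident V (V q₀).length).card : ℝ) ≤ c * (V q₀).length := by
        have h1 : ((noncoincident V (V q₀).length).card : ℝ) + 1 ≤ (V q₀).length := by
          exact_mod_cast hlt
        have h2 : ((V q₀).length : ℝ) ≤ Q := by exact_mod_cast hVQ q₀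
        have h3 : ((V q₀).length : ℝ) / (Q + 1) ≤ 1 := by
          rw [div_le_one hQ0]; linarith
        have h4 : c * (V q₀).length = (V q₀).length - (V q₀).length / (Q + 1) := by
          rw [hc]; ring
        linarith
      have h := card_noncoincident_comp_le hL hK
      calc ((noncoincident (fun q => (V q).flatMap W) ((V q₀).length * L)).card : ℝ)
          ≤ (noncoincident V (V q₀).length).card * (noncoincident W L).card := by exact_mod_cast h
        _ ≤ (c * (V q₀).length) * (c ^ m * L) := by gcongr
        _ = c ^ (m + 1) * ((V q₀).length * L : ℕ) := by push_cast; ring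
  obtain ⟨m, hm⟩ := exists_pow_lt_of_lt_one hε hc1
  obtain ⟨N, W, L, hW, hL, hcard⟩ := key m
  exact ⟨N, W, L, hW, hL, hcard.trans (by gcongr)⟩

end Size

variable {ℓ : ℕ → ℝ}

/-! ### Positions of supertiles in a tiling, and the offset. -/

namespace TilingSpace

theorem eq_of_overlap {n : ℕ} (T : R.TilingSpace n) {s t : ℝ × Fin (R.j n)} (hs : s ∈ T.tiles)
    (ht : t ∈ T.tiles) (h₁ : s.1 < t.1 + R.size n t.2) (h₂ : t.1 < s.1 + R.size n s.2) : s = t := by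
  by_contra hne
  have hd := T.nonoverlapping s hs t ht hne
  simp only [support, interior_Icc, Set.disjoint_left, Set.mem_Ioo, not_and, not_lt] at hd
  have hs' := R.size_pos n s.2
  have ht' := R.size_pos n t.2
  obtain ⟨x, hx⟩ := exists_between
    (show max s.1 t.1 < min (s.1 + R.size n s.2) (t.1 + R.size n t.2) by
      simp only [max_lt_iff, lt_min_iff]; refine ⟨⟨?_, ?_⟩, ?_, ?_⟩ <;> linarith)
  simp only [max_lt_iff, lt_min_iff] at hx
  have := hd ⟨hx.1.1, hx.2.1⟩ hx.1.2
  linarith [hx.2.2]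

theorem mem_translate {n : ℕ} {v : ℝ} {T : R.TilingSpace n} {t : ℝ × Fin (R.j n)} :
    t ∈ (T.translate v).tiles ↔ (t.1 + v, t.2) ∈ T.tiles := Iff.rfl

theorem translate_zero {n : ℕ} (T : R.TilingSpace n) : T.translate 0 = T := by
  ext t
  simp [mem_translate]

theorem continuous_translate {n : ℕ} (v : ℝ) :
    Continuous (TilingSpace.translate v : R.TilingSpace n → R.TilingSpace n) := by
  refine continuous_def.2 fun U hU T hT => ?_
  obtain ⟨ε, hε, h⟩ := hU _ hT
  have hd : 0 < 1 / ε + |v| := by positivity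
  -- The ball of radius `1 / ε + |v|` about the origin contains the ball of radius `1 / ε` about
  -- `v`.
  refine ⟨1 / (1 / ε + |v|), by positivity, fun T' hc => h _ ?_⟩
  obtain ⟨g, g', hg, hg', ht⟩ := hc
  have hle : 1 / (1 / ε + |v|) ≤ ε := by
    rw [div_le_iff₀ hd]
    have : ε * (1 / ε) = 1 := by field_simp
    nlinarith [abs_nonneg v]
  refine ⟨g, g', hg.trans hle, hg'.trans hle, fun t hm => ?_⟩
  have key := ht (t.1 + v, t.2) ?_
  · simp only [mem_translate] at key ⊢
    rw [add_right_comm t.1 g v, add_right_comm t.1 g' v]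
    exact key
  · obtain ⟨x, hx, hxb⟩ := hm
    refine ⟨x + v, ?_, ?_⟩
    · simp only [support, Set.mem_Icc] at hx ⊢
      constructor <;> linarith [hx.1, hx.2]
    · simp only [Metric.mem_closedBall, Real.dist_eq, sub_zero, one_div_one_div] at hxb ⊢
      exact (abs_add_le x v).trans (by linarith)

theorem exists_tile_succ (hℓ : ∀ n i, R.size n i = ℓ n) {n : ℕ} (T : R.TilingSpace n)
    {t : ℝ × Fin (R.j n)} (ht : t ∈ T.tiles) : ∃ u ∈ T.tiles, u.1 = t.1 + ℓ n := by
  have hp : 0 < ℓ n := by rw [← hℓ n t.2]; exact R.size_pos n t.2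
  obtain ⟨u, hu, hux⟩ := T.covers (t.1 + ℓ n + ℓ n / 2)
  simp only [support, Set.mem_Icc, hℓ] at hux
  have hle : t.1 + ℓ n ≤ u.1 := by
    by_contra! h
    have := T.eq_of_overlap hu ht (by rw [hℓ]; exact h) (by rw [hℓ]; linarith [hux.2])
    rw [this] at hux
    linarith [hux.2]
  refine ⟨u, hu, le_antisymm ?_ hle⟩
  by_contra! h
  obtain ⟨w, hw, hwx⟩ := T.covers ((t.1 + ℓ n + u.1) / 2)
  simp only [support, Set.mem_Icc, hℓ] at hwx
  have hwu : w.1 < u.1 := by linarith [hwx.1]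
  have hwt : t.1 < w.1 + ℓ n := by linarith [hwx.2]
  rcases lt_or_ge w.1 (t.1 + ℓ n) with h1 | h1
  · have := T.eq_of_overlap hw ht (by rw [hℓ]; exact h1) (by rw [hℓ]; exact hwt)
    rw [this] at hwx
    linarith [hwx.2]
  · have := T.eq_of_overlap hw hu (by rw [hℓ]; linarith) (by rw [hℓ]; linarith [hux.1])
    rw [this] at hwu
    exact lt_irrefl _ hwu

theorem exists_zsmul_eq (hℓ : ∀ n i, R.size n i = ℓ n) {n : ℕ} (T : R.TilingSpace n)
    {s t : ℝ × Fin (R.j n)} (hs : s ∈ T.tiles) (ht : t ∈ T.tiles) :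
    ∃ m : ℤ, s.1 = t.1 + m * ℓ n := by
  have hp : 0 < ℓ n := by rw [← hℓ n t.2]; exact R.size_pos n t.2
  wlog hst : t.1 ≤ s.1 generalizing s t
  · obtain ⟨m, hm⟩ := this ht hs (le_of_not_ge hst)
    exact ⟨-m, by push_cast; linarith⟩
  have key : ∀ m : ℕ, ∃ u ∈ T.tiles, u.1 = t.1 + m * ℓ n := by
    intro m
    induction m with
    | zero => exact ⟨t, ht, by simp⟩
    | succ m ih =>
      obtain ⟨u, hu, hum⟩ := ih
      obtain ⟨w, hw, hwu⟩ := T.exists_tile_succ hℓ hu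
      exact ⟨w, hw, by rw [hwu, hum]; push_cast; ring⟩
  set m := ⌊(s.1 - t.1) / ℓ n⌋₊ with hm
  have h1 : (m : ℝ) * ℓ n ≤ s.1 - t.1 :=
    (le_div_iff₀ hp).1 (Nat.floor_le (div_nonneg (by linarith) hp.le))
  have h2 : s.1 - t.1 < (m + 1) * ℓ n := (div_lt_iff₀ hp).1 (Nat.lt_floor_add_one _)
  obtain ⟨u, hu, hum⟩ := key m
  have := T.eq_of_overlap hs hu (by rw [hℓ]; linarith) (by rw [hℓ]; linarith)
  exact ⟨m, by rw [this, hum]; simp⟩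

/-- The position of the origin inside its `n`-supertile, in units of the size of the supertile. -/
def offset (ℓ : ℕ → ℝ) {n : ℕ} (T : R.TilingSpace n) : UnitAddCircle :=
  ((-(T.covers 0).choose.1 / ℓ n : ℝ) : UnitAddCircle)

theorem offset_eq (hℓ : ∀ n i, R.size n i = ℓ n) {n : ℕ} (T : R.TilingSpace n)
    {s : ℝ × Fin (R.j n)} (hs : s ∈ T.tiles) :
    T.offset ℓ = ((-s.1 / ℓ n : ℝ) : UnitAddCircle) := by
  have hp : 0 < ℓ n := by rw [← hℓ n s.2]; exact R.size_pos n s.2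
  obtain ⟨m, hm⟩ := T.exists_zsmul_eq hℓ (T.covers 0).choose_spec.1 hs
  have : -(T.covers 0).choose.1 / ℓ n = -s.1 / ℓ n + (-m : ℤ) := by
    rw [hm]; push_cast; field_simp; ring
  rw [offset, this, AddCircle.coe_add]
  rw [show ((((-m : ℤ) : ℝ)) : UnitAddCircle) = 0 from
    (AddCircle.coe_eq_zero_iff (1 : ℝ)).2 ⟨-m, by simp⟩, add_zero]

theorem exists_mem_tiles_of_offset_eq (hℓ : ∀ n i, R.size n i = ℓ n) {n : ℕ} (T : R.TilingSpace n)
    {y : ℝ} (hy : T.offset ℓ = ((-y / ℓ n : ℝ) : UnitAddCircle)) :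
    ∃ s ∈ T.tiles, s.1 = y := by
  -- A tile covering this midpoint starts within `ℓ n / 2` of `y`, and at a multiple of `ℓ n` from
  -- it, hence at `y`.
  obtain ⟨s, hs, hsy⟩ := T.covers (y + ℓ n / 2)
  have hp : 0 < ℓ n := by rw [← hℓ n s.2]; exact R.size_pos n s.2
  simp only [support, Set.mem_Icc, hℓ] at hsy
  rw [T.offset_eq hℓ hs, eq_comm, ← sub_eq_zero, ← AddCircle.coe_sub,
    AddCircle.coe_eq_zero_iff] at hy
  obtain ⟨m, hm⟩ := hy
  have hm' : (m : ℝ) * ℓ n = s.1 - y := by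
    simp only [zsmul_eq_mul, mul_one] at hm
    rw [hm]; field_simp; ring
  have h1 : (m : ℝ) < 1 := by
    by_contra! h
    nlinarith [hsy.1]
  have h2 : (-1 : ℝ) < m := by
    by_contra! h
    nlinarith [hsy.2]
  have h3 : m = 0 := by
    have h1' : m < 1 := by exact_mod_cast h1
    have h2' : -1 < m := by exact_mod_cast h2
    omega
  rw [h3] at hm'
  exact ⟨s, hs, by simp at hm'; linarith⟩

theorem offset_translate (hℓ : ∀ n i, R.size n i = ℓ n) {n : ℕ} (v : ℝ) (T : R.TilingSpace n) :
    (T.translate v).offset ℓ = T.offset ℓ + ((v / ℓ n : ℝ) : UnitAddCircle) := by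
  obtain ⟨s, hs, -⟩ := T.covers 0
  rw [T.offset_eq hℓ hs, (T.translate v).offset_eq hℓ (s := (s.1 - v, s.2))
    (by simpa [mem_translate] using hs), ← AddCircle.coe_add]
  congr 1
  ring

/-- Close tilings share the tile at the origin after translations by `g` and `g'`, so their offsets
differ by `(g - g') / ℓ n`. -/
theorem continuous_offset (hℓ : ∀ n i, R.size n i = ℓ n) (n : ℕ) :
    Continuous fun T : R.TilingSpace n => T.offset ℓ := by
  refine continuous_def.2 fun V hV T hT => ?_
  have hc : Continuous fun v : ℝ => T.offset ℓ + ((v / ℓ n : ℝ) : UnitAddCircle) :=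
    continuous_const.add (AddCircle.continuous_mk' 1 |>.comp (continuous_id.div_const _))
  obtain ⟨δ, hδ, hδV⟩ := Metric.isOpen_iff.1 (hV.preimage hc) 0 (by simpa using hT)
  refine ⟨δ / 3, by positivity, fun T' hcl => ?_⟩
  obtain ⟨g, g', hg, hg', ht⟩ := hcl
  obtain ⟨s, hs, hsg⟩ := T.covers g
  have h' := (ht (s.1 - g, s.2) ⟨0, ?_, ?_⟩).1 (by simpa [mem_translate] using hs)
  · have hmem : g - g' ∈ Metric.ball (0 : ℝ) δ := by
      rw [Metric.mem_ball, Real.dist_eq, sub_zero]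
      calc |g - g'| ≤ |g| + |g'| := abs_sub _ _
        _ < δ := by linarith
    have := hδV hmem
    simp only [Set.mem_preimage] at this ⊢
    rw [mem_translate] at h'
    rw [T.offset_eq hℓ hs, ← AddCircle.coe_add] at this
    rw [T'.offset_eq hℓ h']
    convert this using 2
    ring
  · simp only [support, Set.mem_Icc] at hsg ⊢
    constructor <;> linarith [hsg.1, hsg.2]
  · simp only [Metric.mem_closedBall, dist_self]
    positivity

end TilingSpace

/-! ### Subdivision down to prototiles and the map to the solenoid. -/

theorem mem_subdivideAll_of_mem_down {n : ℕ} {S : Set (ℝ × Fin (R.j n))} {s : ℝ × Fin (R.j n)}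
    (hs : s ∈ S) {t : ℝ × Fin (R.j 0)} (ht : t ∈ placeWord (R.size 0) s.1 (R.down n s.2)) :
    t ∈ R.subdivideAll n S := by
  induction n with
  | zero => simp [down, placeWord] at ht; subst ht; exact hs
  | succ n ih =>
    obtain ⟨u, hu, htu⟩ := (mem_placeWord_flatMap (sum_map_size_down n) _ _ _).1 ht
    exact ih (S := R.subdivide n S) ⟨s, hs, hu⟩ htu

theorem Recognizable.exists_homeomorph (hrec : R.Recognizable) :
    ∃ H : ∀ n, R.TilingSpace n ≃ₜ R.TilingSpace 0,
      (∀ n S, (H n S).tiles = R.subdivideAll n S.tiles) ∧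
      ∀ n T, ((H n).symm T).tiles = R.subdivide n ((H (n + 1)).symm T).tiles := by
  choose h hh using hrec
  let H : ∀ n, R.TilingSpace n ≃ₜ R.TilingSpace 0 := fun n =>
    Nat.rec (Homeomorph.refl _) (fun n e => (h n).trans e) n
  refine ⟨H, fun n => ?_, fun n T => ?_⟩
  · induction n with
    | zero => exact fun S => rfl
    | succ n ih =>
      intro S
      change (H n (h n S)).tiles = _
      rw [ih, hh]
      rfl
  · rw [← hh]
    change _ = ((h n) ((h n).symm ((H n).symm T))).tiles
    rw [Homeomorph.apply_symm_apply]

theorem mem_placeWord_sub {α : Type} {ℓ : α → ℝ} {v x : ℝ} {w : List α} {t : ℝ × α} :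
    (t.1 + v, t.2) ∈ placeWord ℓ x w ↔ t ∈ placeWord ℓ (x - v) w := by
  constructor
  · intro h
    have := mem_placeWord_add ℓ v w (x - v) _ (by simpa using h)
    simpa using this
  · intro h
    have := mem_placeWord_add ℓ (-v) w x t (by simpa [sub_eq_add_neg] using h)
    simpa using this

theorem mem_subdivideAll_translate {n : ℕ} (v : ℝ) (S : Set (ℝ × Fin (R.j n))) :
    R.subdivideAll n {t | (t.1 + v, t.2) ∈ S} = {t | (t.1 + v, t.2) ∈ R.subdivideAll n S} := by
  induction n with
  | zero => rfl
  | succ n ih =>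
    have : R.subdivide n {t | (t.1 + v, t.2) ∈ S} = {t | (t.1 + v, t.2) ∈ R.subdivide n S} := by
      ext t
      constructor
      · rintro ⟨s, hs, ht⟩
        refine ⟨(s.1 + v, s.2), hs, mem_placeWord_sub.2 (by simpa using ht)⟩
      · rintro ⟨s, hs, ht⟩
        exact ⟨(s.1 - v, s.2), by simpa using hs, mem_placeWord_sub.1 ht⟩
    change R.subdivideAll n (R.subdivide n _) = _
    rw [this, ih]
    rfl

/-- The translation by `v` in the solenoid. -/
def flow (hℓ : ∀ n i, R.size n i = ℓ n) (v : ℝ) : R.solenoid :=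
  ⟨fun n => ((v / ℓ n : ℝ) : UnitAddCircle), fun n i => by
    have h := word_length_mul hℓ n i
    have hp : 0 < ℓ (n + 1) := by rw [← hℓ (n + 1) i]; exact R.size_pos _ i
    have hp' : ℓ n ≠ 0 := by rintro h0; rw [h0, mul_zero] at h; exact hp.ne h
    rw [← AddCircle.coe_nsmul, nsmul_eq_mul]
    congr 1
    rw [← h]
    have : ((R.word n i).length : ℝ) ≠ 0 := by
      intro h0; rw [h0, zero_mul] at h; exact hp.ne h
    field_simp⟩

theorem exists_solenoidMap (hℓ : ∀ n i, R.size n i = ℓ n)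
    (H : ∀ n, R.TilingSpace n ≃ₜ R.TilingSpace 0)
    (hH : ∀ n S, (H n S).tiles = R.subdivideAll n S.tiles)
    (hH' : ∀ n T, ((H n).symm T).tiles = R.subdivide n ((H (n + 1)).symm T).tiles) :
    ∃ π : R.TilingSpace 0 → R.solenoid, Continuous π ∧ IsSolenoidMap π ∧
      (∀ v T, π (T.translate v) = π T + flow hℓ v) ∧
      ∀ n T, (π T : ℕ → UnitAddCircle) n = ((H n).symm T).offset ℓ := by
  have hmem : ∀ T, (fun n => ((H n).symm T).offset ℓ) ∈ R.solenoid := by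
    intro T n i
    obtain ⟨s, hs, -⟩ := ((H (n + 1)).symm T).covers 0
    -- The first `n`-supertile of `s` has the same left endpoint as `s`, so the two offsets differ
    -- only by the ratio of the sizes.
    obtain ⟨p, w, hw⟩ := List.exists_cons_of_ne_nil (R.word_ne_nil n s.2)
    have hsub : (s.1, p) ∈ ((H n).symm T).tiles := by
      rw [hH']
      exact ⟨s, hs, by simp [hw, placeWord]⟩
    change _ • ((H (n + 1)).symm T).offset ℓ = ((H n).symm T).offset ℓ
    rw [TilingSpace.offset_eq hℓ _ hs, TilingSpace.offset_eq hℓ _ hsub, ← AddCircle.coe_nsmul,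
      nsmul_eq_mul]
    congr 1
    have h := word_length_mul hℓ n i
    have hp : 0 < ℓ (n + 1) := by rw [← hℓ (n + 1) i]; exact R.size_pos _ i
    have hp' : ℓ n ≠ 0 := by rintro h0; rw [h0, mul_zero] at h; exact hp.ne h
    have : ((R.word n i).length : ℝ) ≠ 0 := by
      intro h0; rw [h0, zero_mul] at h; exact hp.ne h
    rw [← h]
    field_simp
  refine ⟨fun T => ⟨_, hmem T⟩, ?_, ?_, ?_, fun n T => rfl⟩
  · refine Continuous.subtype_mk (continuous_pi fun n => ?_) _
    exact (TilingSpace.continuous_offset hℓ n).comp (H n).symm.continuous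
  · intro T n S hS s hs
    have : (H n).symm T = S := by
      rw [Homeomorph.symm_apply_eq]
      exact TilingSpace.ext (by rw [hH, hS])
    rw [hℓ]
    change ((H n).symm T).offset ℓ = _
    rw [this]
    exact TilingSpace.offset_eq hℓ S hs
  · intro v T
    refine Subtype.ext (funext fun n => ?_)
    change ((H n).symm (T.translate v)).offset ℓ =
      ((H n).symm T).offset ℓ + ((v / ℓ n : ℝ) : UnitAddCircle)
    rw [← TilingSpace.offset_translate hℓ]
    congr 1
    rw [Homeomorph.symm_apply_eq]
    refine TilingSpace.ext ?_
    rw [hH]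
    simp only [TilingSpace.translate]
    rw [mem_subdivideAll_translate, ← hH, Homeomorph.apply_symm_apply]

/-! ### Agreement on balls, limits, and patches forced by an offset. -/

namespace TilingSpace

/-- Two tilings have the same tiles meeting the ball of radius `r` around the origin. -/
def Agree (r : ℝ) (T T' : R.TilingSpace 0) : Prop :=
  ∀ t : ℝ × Fin (R.j 0), (R.support 0 t ∩ Metric.closedBall 0 r).Nonempty →
    (t ∈ T.tiles ↔ t ∈ T'.tiles)

theorem Agree.close {r ε v : ℝ} (hr : 1 / ε ≤ r) (hv : |v| ≤ ε) {T T' : R.TilingSpace 0}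
    (h : Agree r T (T'.translate v)) : TilingSpace.Close ε T T' := by
  refine ⟨0, v, by simpa using (abs_nonneg v).trans hv, hv, fun t ht => ?_⟩
  rw [translate_zero]
  exact h t (ht.mono (Set.inter_subset_inter_right _ (Metric.closedBall_subset_closedBall hr)))

theorem eq_of_forall_agree {T T' : R.TilingSpace 0} (h : ∀ r : ℕ, Agree r T T') : T = T' := by
  refine TilingSpace.ext (Set.ext fun t => ?_)
  obtain ⟨r, hr⟩ := exists_nat_ge |t.1|
  refine h r t ⟨t.1, ⟨le_rfl, ?_⟩, by simpa using hr⟩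
  linarith [R.size_pos 0 t.2]

theorem agree_of_patch {r y : ℝ} {w : List (Fin (R.j 0))} (hy : y < -r)
    (hw : r < y + (w.map (R.size 0)).sum) {T T' : R.TilingSpace 0}
    (hT : ∀ t ∈ placeWord (R.size 0) y w, t ∈ T.tiles)
    (hT' : ∀ t ∈ placeWord (R.size 0) y w, t ∈ T'.tiles) : Agree r T T' := by
  have key : ∀ T : R.TilingSpace 0, (∀ t ∈ placeWord (R.size 0) y w, t ∈ T.tiles) →
      ∀ t ∈ T.tiles, (R.support 0 t ∩ Metric.closedBall 0 r).Nonempty →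
        t ∈ placeWord (R.size 0) y w := by
    rintro T hT t ht ⟨u, hut, hur⟩
    simp only [support, Set.mem_Icc, Metric.mem_closedBall, Real.dist_eq, sub_zero, abs_le]
      at hut hur
    have hp := R.size_pos 0 t.2
    -- `t` may meet the ball only in an endpoint; the patch extends strictly beyond the ball, so
    -- their interiors still meet.
    obtain ⟨x, hx⟩ := exists_between
      (show max t.1 y < min (t.1 + R.size 0 t.2) (y + (w.map (R.size 0)).sum) by
        simp only [max_lt_iff, lt_min_iff]; refine ⟨⟨?_, ?_⟩, ?_, ?_⟩ <;> linarith)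
    simp only [max_lt_iff, lt_min_iff] at hx
    obtain ⟨s, hs, h1, h2⟩ := exists_mem_placeWord w hx.1.2.le hx.2.2
    rwa [T.eq_of_overlap ht (hT s hs) (by linarith [hx.1.1]) (by linarith [hx.2.1])]
  exact fun t hm => ⟨fun ht => hT' t (key T hT t ht hm), fun ht => hT t (key T' hT' t ht hm)⟩

/-- The limit consists of the tiles eventually present. Admission of a patch involves finitely many
tiles, all found in a single `T k`. -/
theorem exists_forall_agree (T : ℕ → R.TilingSpace 0)
    (h : ∀ r : ℕ, ∃ n₀, ∀ n ≥ n₀, Agree r (T n₀) (T n)) :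
    ∃ T' : R.TilingSpace 0, ∀ r : ℕ, ∃ n₀, ∀ n ≥ n₀, Agree r T' (T n) := by
  have key : ∀ r : ℕ, ∃ n₀, ∀ n ≥ n₀, ∀ t : ℝ × Fin (R.j 0),
      (R.support 0 t ∩ Metric.closedBall 0 (r : ℝ)).Nonempty →
        ((∀ᶠ k in Filter.atTop, t ∈ (T k).tiles) ↔ t ∈ (T n).tiles) := by
    intro r
    obtain ⟨n₀, hn₀⟩ := h r
    refine ⟨n₀, fun n hn t ht => ?_⟩
    rw [← hn₀ n hn t ht]
    constructor
    · intro he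
      obtain ⟨k, hk, hk'⟩ := (he.and (Filter.eventually_ge_atTop n₀)).exists
      exact (hn₀ k hk' t ht).2 hk
    · intro ht'
      exact (Filter.eventually_ge_atTop n₀).mono fun k hk => (hn₀ k hk t ht).1 ht'
  refine ⟨⟨{t | ∀ᶠ k in Filter.atTop, t ∈ (T k).tiles}, fun x => ?_, fun s hs t ht hst => ?_,
    fun x w hw => ?_⟩, key⟩
  · obtain ⟨r, hr⟩ := exists_nat_ge |x|
    obtain ⟨n₀, hn₀⟩ := key r
    obtain ⟨t, ht, hx⟩ := (T n₀).covers x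
    exact ⟨t, (hn₀ n₀ le_rfl t ⟨x, hx, by simpa using hr⟩).2 ht, hx⟩
  · obtain ⟨k, hks, hkt⟩ := (Filter.Eventually.and hs ht).exists
    exact (T k).nonoverlapping s hks t hkt hst
  · have := (Filter.eventually_all_finite (List.finite_toSet (placeWord (R.size 0) x w))).2 hw
    obtain ⟨k, hk⟩ := this.exists
    exact (T k).admitted x w hk

theorem tendsto_of_forall_agree {T : ℕ → R.TilingSpace 0} {T' : R.TilingSpace 0}
    (h : ∀ r : ℕ, ∃ n₀, ∀ n ≥ n₀, Agree r T' (T n)) :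
    Filter.Tendsto T Filter.atTop (nhds T') := by
  refine tendsto_nhds.2 fun U hU hT' => ?_
  obtain ⟨ε, hε, hεU⟩ := hU T' hT'
  obtain ⟨r, hr⟩ := exists_nat_ge (1 / ε)
  obtain ⟨n₀, hn₀⟩ := h r
  refine (Filter.eventually_ge_atTop n₀).mono fun n hn => hεU _ ?_
  exact Agree.close (v := 0) hr (by simpa using hε.le) (by rw [translate_zero]; exact hn₀ n hn)

/-- Arbitrarily long patches of the given tiling are admitted, hence fit inside supertiles. -/
theorem exists_lt_size (hℓ : ∀ n i, R.size n i = ℓ n) (T : R.TilingSpace 0) (r : ℝ) :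
    ∃ n, r < ℓ n := by
  have key : ∀ m : ℕ, ∀ t ∈ T.tiles, ∃ w : List (Fin (R.j 0)), w.length = m ∧
      ∀ u ∈ placeWord (R.size 0) t.1 w, u ∈ T.tiles := by
    intro m
    induction m with
    | zero => exact fun t _ => ⟨[], rfl, by simp [placeWord]⟩
    | succ m ih =>
      intro t ht
      obtain ⟨u, hu, hut⟩ := T.exists_tile_succ hℓ ht
      obtain ⟨w, hw, hwT⟩ := ih u hu
      refine ⟨t.2 :: w, by simp [hw], fun s hs => ?_⟩
      rw [placeWord, List.mem_cons, hℓ, ← hut] at hs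
      rcases hs with rfl | hs
      · exact ht
      · exact hwT s hs
  obtain ⟨t, ht, -⟩ := T.covers 0
  have hp : 0 < ℓ 0 := by rw [← hℓ 0 t.2]; exact R.size_pos 0 t.2
  obtain ⟨m, hm⟩ := exists_nat_gt (r / ℓ 0)
  obtain ⟨w, hw, hwT⟩ := key m t ht
  obtain ⟨k, i, hki⟩ := T.admitted _ w hwT
  refine ⟨0 + k, ?_⟩
  rw [← (isExpansion_expand 0 k).length_mul hℓ i]
  have h1 : (m : ℝ) ≤ (R.expand 0 k i).length := by
    rw [← hw]; exact_mod_cast hki.length_le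
  rw [div_lt_iff₀ hp] at hm
  exact hm.trans_le (by gcongr)

/-- Both tilings have an `N`-supertile starting at `-(τ * ℓ N)`. Whatever their types, the `i`-th
`n`-supertile is `p`, and the inequalities place the ball strictly inside it. -/
theorem agree_of_offset_eq (hℓ : ∀ n i, R.size n i = ℓ n)
    {n N : ℕ} {W : Fin (R.j N) → List (Fin (R.j n))} (hW : R.IsExpansion n N W) {i : ℕ}
    {p : Fin (R.j n)} (hp : ∀ q, (W q)[i]? = some p) {r τ : ℝ} (h₁ : i * ℓ n + r < τ * ℓ N)
    (h₂ : τ * ℓ N < (i + 1) * ℓ n - r) {T T' : R.TilingSpace 0} {S S' : R.TilingSpace N}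
    (hS : R.subdivideAll N S.tiles = T.tiles) (hS' : R.subdivideAll N S'.tiles = T'.tiles)
    (hτ : S.offset ℓ = (τ : UnitAddCircle)) (hτ' : S'.offset ℓ = (τ : UnitAddCircle)) :
    Agree r T T' := by
  have key : ∀ (T : R.TilingSpace 0) (S : R.TilingSpace N),
      R.subdivideAll N S.tiles = T.tiles → S.offset ℓ = (τ : UnitAddCircle) →
      ∀ t ∈ placeWord (R.size 0) (-(τ * ℓ N) + i * ℓ n) (R.down n p), t ∈ T.tiles := by
    intro T S hS hτ t ht
    have hN : 0 < ℓ N := by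
      obtain ⟨s, -⟩ := S.covers 0
      rw [← hℓ N s.2]; exact R.size_pos N s.2
    obtain ⟨s, hs, hsτ⟩ := S.exists_mem_tiles_of_offset_eq hℓ (y := -(τ * ℓ N)) (by
      rw [hτ]; congr 1; field_simp)
    rw [← hS]
    refine mem_subdivideAll_of_mem_down hs ?_
    rw [hW.down_eq, mem_placeWord_flatMap (sum_map_size_down n)]
    refine ⟨_, mem_placeWord_of_getElem? (hℓ n) _ (hp s.2), ?_⟩
    rw [hsτ]
    exact ht
  refine agree_of_patch (y := -(τ * ℓ N) + i * ℓ n) (w := R.down n p) (by linarith) ?_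
    (key T S hS hτ) (key T' S' hS' hτ')
  rw [sum_map_size_down, hℓ]
  linarith

end TilingSpace

/-- `E` collects the offsets that put the origin in a coincident `n`-supertile, at distance more
than `r` from its ends. -/
theorem exists_isOpen_agree [∀ n, Nonempty (Fin (R.j n))] (hne : Nonempty (R.TilingSpace 0))
    (hℓ : ∀ n i, R.size n i = ℓ n) (hpos : ∀ n, 0 < ℓ n) (hreg : R.PrototileRegular)
    (hcoin : R.CoincidentWithFiniteWaiting) (hbdd : R.UniformlyBoundedTransitions)
    {r : ℝ} (hr : 0 ≤ r) {ε : ℝ} (hε : 0 < ε) (hε1 : ε ≤ 1) :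
    ∃ N, ∃ E : Set UnitAddCircle, IsOpen E ∧ volume Eᶜ ≤ ENNReal.ofReal ε ∧
      ∀ (T T' : R.TilingSpace 0) (S S' : R.TilingSpace N), R.subdivideAll N S.tiles = T.tiles →
        R.subdivideAll N S'.tiles = T'.tiles → S.offset ℓ ∈ E → S'.offset ℓ = S.offset ℓ →
          TilingSpace.Agree r T T' := by
  classical
  obtain ⟨T₀⟩ := hne
  -- The margins `2 * r` then cost at most a fraction `ε / 2` of each `n`-supertile; bad positions
  -- cost another `ε / 2`, and `(1 - ε / 2) ^ 2 ≥ 1 - ε`.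
  obtain ⟨n, hn⟩ := T₀.exists_lt_size hℓ (4 * r / ε)
  obtain ⟨N, W, L, hW, hL, hcard⟩ :=
    exists_card_noncoincident_le hℓ hpos hreg hcoin hbdd (half_pos hε) n
  obtain ⟨q₀⟩ := (inferInstance : Nonempty (Fin (R.j N)))
  have hLℓ : L * ℓ n = ℓ N := by rw [← hL q₀]; exact hW.length_mul hℓ q₀
  have hN := hpos N
  have hn0 := hpos n
  rw [div_lt_iff₀ hε] at hn
  set C := Finset.range L \ noncoincident W L with hC
  set I : ℕ → Set ℝ := fun i => Set.Ioo ((i * ℓ n + r) / ℓ N) (((i + 1) * ℓ n - r) / ℓ N) with hI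
  have hopen : IsOpen (⋃ i ∈ C, I i) := isOpen_biUnion fun _ _ => isOpen_Ioo
  set E : Set UnitAddCircle := (fun x : ℝ => (x : UnitAddCircle)) '' ⋃ i ∈ C, I i with hE
  have hEo : IsOpen E := QuotientAddGroup.isOpenMap_coe _ hopen
  refine ⟨N, E, hEo, ?_, ?_⟩
  -- Inside one fundamental domain, projection to the circle loses no measure.
  · have hsub : (⋃ i ∈ C, I i) ⊆ Set.Ioc (0 : ℝ) (0 + 1) := by
      refine Set.iUnion₂_subset fun i hi x hx => ?_
      have hiL : ((i : ℝ) + 1) ≤ L := by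
        have := (Finset.mem_sdiff.1 hi).1
        rw [Finset.mem_range] at this
        exact_mod_cast this
      refine ⟨lt_of_le_of_lt (by positivity) hx.1, hx.2.le.trans ?_⟩
      rw [div_le_iff₀ hN, ← hLℓ]
      nlinarith
    have hdisj : Set.PairwiseDisjoint (C : Set ℕ) I := by
      have hlt : ∀ i i' : ℕ, i < i' → Disjoint (I i) (I i') := by
        intro i i' hii'
        rw [Set.disjoint_left]
        intro x hx hx'
        have h := hx'.1.trans hx.2
        rw [div_lt_div_iff_of_pos_right hN] at h
        have : ((i : ℝ) + 1) ≤ i' := by exact_mod_cast hii'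
        nlinarith
      intro i _ i' _ hii'
      rcases lt_or_gt_of_ne hii' with h | h
      · exact hlt i i' h
      · exact (hlt i' i h).symm
    have hvol : volume (⋃ i ∈ C, I i) = ENNReal.ofReal (C.card * ((ℓ n - 2 * r) / ℓ N)) := by
      rw [measure_biUnion_finset hdisj fun _ _ => measurableSet_Ioo]
      have : ∀ i ∈ C, volume (I i) = ENNReal.ofReal ((ℓ n - 2 * r) / ℓ N) := by
        intro i _
        rw [hI, Real.volume_Ioo]
        congr 1
        ring
      rw [Finset.sum_congr rfl this, Finset.sum_const, nsmul_eq_mul,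
        ENNReal.ofReal_mul (Nat.cast_nonneg _), ENNReal.ofReal_natCast]
    have hEvol : volume (⋃ i ∈ C, I i) ≤ volume E := by
      have h := (UnitAddCircle.measurePreserving_mk 0).measure_preimage
        hEo.measurableSet.nullMeasurableSet
      rw [← h, Measure.restrict_apply' measurableSet_Ioc]
      exact measure_mono (Set.subset_inter (Set.subset_preimage_image _ _) hsub)
    have hCcard : (1 - ε / 2) * L ≤ C.card := by
      have h1 : C.card + (noncoincident W L).card = L := by
        rw [hC, Finset.card_sdiff_add_card_eq_card, Finset.card_range]
        exact Finset.filter_subset _ _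
      have h2 : (C.card : ℝ) + (noncoincident W L).card = L := by exact_mod_cast h1
      linarith
    have hfin : 1 - ε ≤ C.card * ((ℓ n - 2 * r) / ℓ N) := by
      rw [← mul_div_assoc, le_div_iff₀ hN, ← hLℓ]
      have h3 : (1 - ε / 2) * ℓ n ≤ ℓ n - 2 * r := by nlinarith
      have h4 : 0 ≤ (1 - ε / 2) * ℓ n := by
        apply mul_nonneg _ hn0.le; linarith
      calc (1 - ε) * (L * ℓ n) ≤ (1 - ε / 2) * L * ((1 - ε / 2) * ℓ n) := by
            have : (0 : ℝ) ≤ L * ℓ n := by positivity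
            nlinarith [sq_nonneg ε]
        _ ≤ C.card * (ℓ n - 2 * r) := by gcongr
    rw [measure_compl hEo.measurableSet (measure_ne_top _ _), UnitAddCircle.measure_univ,
      tsub_le_iff_right]
    calc (1 : ENNReal) = ENNReal.ofReal (ε + (1 - ε)) := by simp
      _ ≤ ENNReal.ofReal ε + ENNReal.ofReal (1 - ε) := ENNReal.ofReal_add_le
      _ ≤ ENNReal.ofReal ε + volume E := by
        gcongr
        exact (ENNReal.ofReal_le_ofReal hfin).trans (hvol.symm.le.trans hEvol)
  · rintro T T' S S' hS hS' ⟨τ, hτ, hτE⟩ hSS'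
    simp only [Set.mem_iUnion] at hτ
    obtain ⟨i, hi, hτi⟩ := hτ
    obtain ⟨p, hp⟩ : ∃ p, ∀ q, (W q)[i]? = some p := by
      by_contra hno
      rw [hC, Finset.mem_sdiff] at hi
      exact hi.2 (Finset.mem_filter.2 ⟨hi.1, hno⟩)
    exact TilingSpace.agree_of_offset_eq hℓ hW hp ((div_lt_iff₀ hN).1 hτi.1)
      ((lt_div_iff₀ hN).1 hτi.2) hS hS' hτE.symm (hSS'.trans hτE.symm)

/-! ### The determined set and the measurable section over it. -/

section GoodSet

variable {N : ℕ → ℕ → ℕ} {E : ℕ → ℕ → Set UnitAddCircle} {π : R.TilingSpace 0 → R.solenoid}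

/-- The points of the solenoid all of whose balls are determined by some coordinate, where `E r k`
is a set of values of the coordinate `N r k` that determine the ball of radius `r`. -/
def determined (R : FusionRule) (N : ℕ → ℕ → ℕ) (E : ℕ → ℕ → Set UnitAddCircle) : Set R.solenoid :=
  {z | ∀ r, ∃ k, (z : ℕ → UnitAddCircle) (N r k) ∈ E r k}

theorem continuous_coord (n : ℕ) :
    Continuous fun z : R.solenoid => (z : ℕ → UnitAddCircle) n :=
  (continuous_apply n).comp continuous_subtype_val

theorem measurable_coord (n : ℕ) :
    Measurable fun z : R.solenoid => (z : ℕ → UnitAddCircle) n :=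
  (measurable_pi_apply n).comp measurable_subtype_coe

theorem measurableSet_determined (hE : ∀ r k, IsOpen (E r k)) :
    MeasurableSet (R.determined N E) := by
  have : R.determined N E = ⋂ r, ⋃ k,
      (fun z : R.solenoid => (z : ℕ → UnitAddCircle) (N r k)) ⁻¹' E r k := by
    ext z; simp [determined]
  rw [this]
  exact MeasurableSet.iInter fun r => MeasurableSet.iUnion fun k =>
    measurable_coord _ (hE r k).measurableSet

theorem measure_compl_determined (ν : Measure R.solenoid)
    (hν : ∀ n, ν.map (fun z : R.solenoid => (z : ℕ → UnitAddCircle) n) = volume)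
    (hE : ∀ r k, IsOpen (E r k))
    (hvol : ∀ r k, volume (E r k)ᶜ ≤ ENNReal.ofReal (1 / (k + 1))) :
    ν (R.determined N E)ᶜ = 0 := by
  have : (R.determined N E)ᶜ = ⋃ r, ⋂ k,
      (fun z : R.solenoid => (z : ℕ → UnitAddCircle) (N r k)) ⁻¹' (E r k)ᶜ := by
    ext z; simp [determined]
  rw [this, measure_iUnion_null_iff]
  intro r
  have hle : ∀ k : ℕ, ν (⋂ k, (fun z : R.solenoid => (z : ℕ → UnitAddCircle) (N r k)) ⁻¹'
      (E r k)ᶜ) ≤ ENNReal.ofReal (1 / ((k : ℝ) + 1)) := by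
    intro k
    refine (measure_mono (Set.iInter_subset _ k)).trans ?_
    rw [← Measure.map_apply (measurable_coord _) (hE r k).measurableSet.compl, hν]
    exact hvol r k
  have hlim : Filter.Tendsto (fun k : ℕ => ENNReal.ofReal (1 / ((k : ℝ) + 1))) Filter.atTop
      (nhds 0) := by
    simpa using ENNReal.tendsto_ofReal tendsto_one_div_add_atTop_nhds_zero_nat
  exact le_antisymm (ge_of_tendsto' hlim hle) bot_le

theorem coord_eq_of_le (z w : R.solenoid) [∀ n, Nonempty (Fin (R.j n))] {m n : ℕ} (hmn : m ≤ n)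
    (h : (z : ℕ → UnitAddCircle) n = (w : ℕ → UnitAddCircle) n) :
    (z : ℕ → UnitAddCircle) m = (w : ℕ → UnitAddCircle) m := by
  induction n, hmn using Nat.le_induction with
  | base => exact h
  | succ n _ ih =>
    obtain ⟨i⟩ := (inferInstance : Nonempty (Fin (R.j (n + 1))))
    exact ih (by rw [← z.2 n i, ← w.2 n i, h])

theorem exists_flow_coord_eq (hℓ : ∀ n i, R.size n i = ℓ n) (hpos : ∀ n, 0 < ℓ n) (n : ℕ)
    (x : UnitAddCircle) : ∃ v, (flow hℓ v : ℕ → UnitAddCircle) n = x := by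
  obtain ⟨y, rfl⟩ := QuotientAddGroup.mk_surjective x
  refine ⟨y * ℓ n, ?_⟩
  change ((y * ℓ n / ℓ n : ℝ) : UnitAddCircle) = _
  rw [mul_div_cancel_right₀ _ (hpos n).ne']

theorem injOn_determined
    (hagree : ∀ r k T T', (π T : ℕ → UnitAddCircle) (N r k) ∈ E r k →
      (π T' : ℕ → UnitAddCircle) (N r k) = (π T : ℕ → UnitAddCircle) (N r k) →
      TilingSpace.Agree r T T') : Set.InjOn π (π ⁻¹' R.determined N E) := by
  intro T hT T' _ h
  refine TilingSpace.eq_of_forall_agree fun r => ?_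
  obtain ⟨k, hk⟩ := hT r
  exact hagree r k T T' hk (by rw [h])

/-- Translates of one tiling match ever more coordinates of `z`. As `z` is determined, they
stabilize on every ball, and continuity of `π` sends the limit to `z`. -/
theorem exists_eq_of_mem_determined [∀ n, Nonempty (Fin (R.j n))]
    (hne : Nonempty (R.TilingSpace 0)) (hℓ : ∀ n i, R.size n i = ℓ n) (hpos : ∀ n, 0 < ℓ n)
    (hπ : Continuous π) (hflow : ∀ v T, π (T.translate v) = π T + flow hℓ v)
    (hagree : ∀ r k T T', (π T : ℕ → UnitAddCircle) (N r k) ∈ E r k →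
      (π T' : ℕ → UnitAddCircle) (N r k) = (π T : ℕ → UnitAddCircle) (N r k) →
      TilingSpace.Agree r T T') {z : R.solenoid} (hz : z ∈ R.determined N E) : ∃ T, π T = z := by
  obtain ⟨T₀⟩ := hne
  choose v hv using fun n => exists_flow_coord_eq hℓ hpos n
    ((z : ℕ → UnitAddCircle) n - (π T₀ : ℕ → UnitAddCircle) n)
  have hT : ∀ m n, m ≤ n →
      (π (T₀.translate (v n)) : ℕ → UnitAddCircle) m = (z : ℕ → UnitAddCircle) m := by
    intro m n hmn
    refine coord_eq_of_le _ _ hmn ?_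
    rw [hflow]
    change (π T₀ : ℕ → UnitAddCircle) n + (flow hℓ (v n) : ℕ → UnitAddCircle) n = _
    rw [hv, add_sub_cancel]
  obtain ⟨T, hT'⟩ := TilingSpace.exists_forall_agree (fun n => T₀.translate (v n)) fun r => by
    obtain ⟨k, hk⟩ := hz r
    refine ⟨N r k, fun n hn => hagree r k _ _ ?_ ?_⟩
    · rwa [hT _ _ le_rfl]
    · rw [hT _ _ hn, hT _ _ le_rfl]
  refine ⟨T, Subtype.ext (funext fun m => ?_)⟩
  have h1 := ((continuous_coord m).comp hπ).continuousAt.tendsto.comp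
    (TilingSpace.tendsto_of_forall_agree hT')
  refine tendsto_nhds_unique h1 (tendsto_const_nhds.congr' ?_)
  exact (Filter.eventually_ge_atTop m).mono fun n hn => (hT m n hn).symm

/-- If `z'` is near `z` in the coordinate `N r k`, a small translation of `σ z'` makes that
coordinate equal, and it then fixes the ball of radius `r`. The big ball topology tolerates the
translation. -/
theorem continuousOn_section (hℓ : ∀ n i, R.size n i = ℓ n) (hpos : ∀ n, 0 < ℓ n)
    (hflow : ∀ v T, π (T.translate v) = π T + flow hℓ v)
    (hagree : ∀ r k T T', (π T : ℕ → UnitAddCircle) (N r k) ∈ E r k →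
      (π T' : ℕ → UnitAddCircle) (N r k) = (π T : ℕ → UnitAddCircle) (N r k) →
      TilingSpace.Agree r T T') {σ : R.solenoid → R.TilingSpace 0}
    (hσ : ∀ z ∈ R.determined N E, π (σ z) = z) : ContinuousOn σ (R.determined N E) := by
  intro z hz
  refine tendsto_nhds.2 fun U hU hzU => ?_
  obtain ⟨ε, hε, hεU⟩ := hU _ hzU
  obtain ⟨r, hr⟩ := exists_nat_ge (1 / ε)
  obtain ⟨k, hk⟩ := hz r
  have hN := hpos (N r k)
  have hO : IsOpen ((fun x : ℝ => (x : UnitAddCircle)) ''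
      Set.Ioo (-(ε / ℓ (N r k))) (ε / ℓ (N r k))) := QuotientAddGroup.isOpenMap_coe _ isOpen_Ioo
  have hcont : Continuous fun z' : R.solenoid =>
      (z : ℕ → UnitAddCircle) (N r k) - (z' : ℕ → UnitAddCircle) (N r k) :=
    continuous_const.sub (continuous_coord _)
  have hmem : ∀ᶠ z' : R.solenoid in nhds z, (z : ℕ → UnitAddCircle) (N r k) -
      (z' : ℕ → UnitAddCircle) (N r k) ∈ (fun x : ℝ => (x : UnitAddCircle)) ''
      Set.Ioo (-(ε / ℓ (N r k))) (ε / ℓ (N r k)) := by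
    refine hcont.continuousAt.eventually_mem (hO.mem_nhds ⟨0, ?_, by simp⟩)
    have : 0 < ε / ℓ (N r k) := by positivity
    exact ⟨by linarith, this⟩
  filter_upwards [mem_nhdsWithin_of_mem_nhds hmem, self_mem_nhdsWithin] with z' hz' hz'G
  obtain ⟨x, hx, hxz⟩ := hz'
  refine hεU _ (TilingSpace.Agree.close (v := x * ℓ (N r k)) hr ?_ ?_)
  · rw [abs_mul, abs_of_pos hN]
    have := (abs_lt.2 hx).le
    rwa [le_div_iff₀ hN] at this
  · refine hagree r k _ _ (by rwa [hσ z hz]) ?_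
    rw [hflow, hσ z hz, hσ z' hz'G]
    change (z' : ℕ → UnitAddCircle) _ + ((x * ℓ (N r k) / ℓ (N r k) : ℝ) : UnitAddCircle) = _
    rw [mul_div_cancel_right₀ _ hN.ne']
    simp only at hxz
    rw [hxz, add_sub_cancel]

theorem exists_measurable_section [∀ n, Nonempty (Fin (R.j n))]
    (hne : Nonempty (R.TilingSpace 0)) (hℓ : ∀ n i, R.size n i = ℓ n) (hpos : ∀ n, 0 < ℓ n)
    (hπ : Continuous π) (hflow : ∀ v T, π (T.translate v) = π T + flow hℓ v)
    (hE : ∀ r k, IsOpen (E r k))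
    (hagree : ∀ r k T T', (π T : ℕ → UnitAddCircle) (N r k) ∈ E r k →
      (π T' : ℕ → UnitAddCircle) (N r k) = (π T : ℕ → UnitAddCircle) (N r k) →
      TilingSpace.Agree r T T') :
    ∃ σ : R.solenoid → R.TilingSpace 0, Measurable σ ∧ ∀ z ∈ R.determined N E, π (σ z) = z := by
  classical
  have hex : ∀ z, ∃ T, z ∈ R.determined N E → π T = z := by
    intro z
    by_cases hz : z ∈ R.determined N E
    · obtain ⟨T, hT⟩ := exists_eq_of_mem_determined hne hℓ hpos hπ hflow hagree hz
      exact ⟨T, fun _ => hT⟩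
    · exact ⟨hne.some, fun h => absurd h hz⟩
  choose σ hσ using hex
  refine ⟨(R.determined N E).piecewise σ fun _ => hne.some, ?_, fun z hz => ?_⟩
  · exact (continuousOn_section hℓ hpos hflow hagree hσ).measurable_piecewise continuousOn_const
      (measurableSet_determined hE)
  · rw [Set.piecewise_eq_of_mem _ _ _ hz]
    exact hσ z hz

end GoodSet

instance : CompactSpace R.solenoid := by
  have hc : IsClosed (R.solenoid : Set (ℕ → UnitAddCircle)) := by
    have : (R.solenoid : Set (ℕ → UnitAddCircle)) =
        ⋂ n, ⋂ i : Fin (R.j (n + 1)), {z | (R.word n i).length • z (n + 1) = z n} := by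
      ext z
      simp only [Set.mem_iInter]
      rfl
    rw [this]
    refine isClosed_iInter fun n => isClosed_iInter fun i => isClosed_eq ?_ (continuous_apply n)
    exact (continuous_nsmul _).comp (continuous_apply (n + 1))
  exact isCompact_iff_compactSpace.1 hc.isCompact

/-! ### Measures on the solenoid through their coordinates. -/

section Marginals

theorem exists_nsmul_coord [∀ n, Nonempty (Fin (R.j n))] {m n : ℕ} (hmn : m ≤ n) :
    ∃ P : ℕ, ∀ z : R.solenoid,
      P • (z : ℕ → UnitAddCircle) n = (z : ℕ → UnitAddCircle) m := by
  induction n, hmn using Nat.le_induction with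
  | base => exact ⟨1, fun z => one_nsmul _⟩
  | succ n _ ih =>
    obtain ⟨P, hP⟩ := ih
    obtain ⟨i⟩ := (inferInstance : Nonempty (Fin (R.j (n + 1))))
    exact ⟨P * (R.word n i).length, fun z => by rw [mul_nsmul', z.2 n i, hP]⟩

/-- Earlier coordinates are multiples of later ones, so sets depending on a single coordinate
already form a π-system. -/
theorem ext_of_map_coord [∀ n, Nonempty (Fin (R.j n))] {ν ν' : Measure R.solenoid}
    [IsFiniteMeasure ν]
    (h : ∀ n, ν.map (fun z : R.solenoid => (z : ℕ → UnitAddCircle) n) =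
      ν'.map fun z : R.solenoid => (z : ℕ → UnitAddCircle) n) : ν = ν' := by
  set C : Set (Set R.solenoid) := {s | ∃ n, ∃ A : Set UnitAddCircle, MeasurableSet A ∧
    (fun z : R.solenoid => (z : ℕ → UnitAddCircle) n) ⁻¹' A = s} with hC
  have happly : ∀ n, ∀ A : Set UnitAddCircle, MeasurableSet A →
      ν ((fun z : R.solenoid => (z : ℕ → UnitAddCircle) n) ⁻¹' A) =
      ν' ((fun z : R.solenoid => (z : ℕ → UnitAddCircle) n) ⁻¹' A) := by
    intro n A hA
    rw [← Measure.map_apply (measurable_coord n) hA, h,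
      Measure.map_apply (measurable_coord n) hA]
  refine ext_of_generate_finite C ?_ ?_ ?_ (by simpa using happly 0 Set.univ MeasurableSet.univ)
  · refine le_antisymm ?_ (MeasurableSpace.generateFrom_le ?_)
    · rw [show (Subtype.instMeasurableSpace : MeasurableSpace R.solenoid) =
        MeasurableSpace.comap Subtype.val MeasurableSpace.pi from rfl, MeasurableSpace.pi,
        MeasurableSpace.comap_iSup]
      refine iSup_le fun n => ?_
      rw [MeasurableSpace.comap_comp]
      rintro s ⟨A, hA, rfl⟩
      exact MeasurableSpace.measurableSet_generateFrom ⟨n, A, hA, rfl⟩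
    · rintro s ⟨n, A, hA, rfl⟩
      exact measurable_coord n hA
  · have hle : ∀ m n, m ≤ n → ∀ A B : Set UnitAddCircle, MeasurableSet A → MeasurableSet B →
        (fun z : R.solenoid => (z : ℕ → UnitAddCircle) m) ⁻¹' A ∩
          (fun z : R.solenoid => (z : ℕ → UnitAddCircle) n) ⁻¹' B ∈ C := by
      intro m n hmn A B hA hB
      obtain ⟨P, hP⟩ := exists_nsmul_coord (R := R) hmn
      refine ⟨n, (fun x => P • x) ⁻¹' A ∩ B,
        ((continuous_nsmul P).measurable hA).inter hB, ?_⟩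
      ext z
      simp [hP]
    rintro _ ⟨m, A, hA, rfl⟩ _ ⟨n, B, hB, rfl⟩ -
    rcases le_total m n with hmn | hmn
    · exact hle m n hmn A B hA hB
    · rw [Set.inter_comm]
      exact hle n m hmn B A hB hA
  · rintro s ⟨n, A, hA, rfl⟩
    exact happly n A hA

theorem eq_volume_of_invariant (ν : Measure UnitAddCircle) [IsProbabilityMeasure ν]
    (h : ∀ g, ν.map (g + ·) = ν) : ν = volume := by
  have : ν.IsAddLeftInvariant := ⟨h⟩
  have : ν.IsAddHaarMeasure := Measure.isAddHaarMeasure_of_isCompact_nonempty_interior ν Set.univ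
    isCompact_univ (by simp) (by simp) (by simp)
  have : IsProbabilityMeasure (volume : Measure UnitAddCircle) := ⟨UnitAddCircle.measure_univ⟩
  exact Measure.isAddHaarMeasure_eq_of_isProbabilityMeasure _ _

theorem map_coord_eq_volume (hℓ : ∀ n i, R.size n i = ℓ n) (hpos : ∀ n, 0 < ℓ n)
    (ν : Measure R.solenoid) [IsProbabilityMeasure ν]
    (hν : ∀ v, ν.map (· + flow hℓ v) = ν) (n : ℕ) :
    ν.map (fun z : R.solenoid => (z : ℕ → UnitAddCircle) n) = volume := by
  have : IsProbabilityMeasure (ν.map (fun z : R.solenoid => (z : ℕ → UnitAddCircle) n)) :=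
    Measure.isProbabilityMeasure_map (measurable_coord n).aemeasurable
  refine eq_volume_of_invariant _ fun g => ?_
  obtain ⟨v, rfl⟩ := exists_flow_coord_eq hℓ hpos n g
  conv_rhs => rw [← hν v]
  rw [Measure.map_map (measurable_const_add _) (measurable_coord n),
    Measure.map_map (measurable_coord n) (measurable_add_const _)]
  congr 1
  funext z
  exact add_comm _ _

theorem isAddHaarMeasure_of_map_coord [∀ n, Nonempty (Fin (R.j n))] (ν : Measure R.solenoid)
    [IsProbabilityMeasure ν]
    (hν : ∀ n, ν.map (fun z : R.solenoid => (z : ℕ → UnitAddCircle) n) = volume) :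
    ν.IsAddHaarMeasure := by
  have : ν.IsAddLeftInvariant := by
    refine ⟨fun g => ?_⟩
    have : IsProbabilityMeasure (ν.map (g + ·)) :=
      Measure.isProbabilityMeasure_map (measurable_const_add g).aemeasurable
    refine ext_of_map_coord fun n => ?_
    rw [Measure.map_map (measurable_coord n) (measurable_const_add g)]
    have : (fun z : R.solenoid => (z : ℕ → UnitAddCircle) n) ∘ (g + ·) =
        ((g : ℕ → UnitAddCircle) n + ·) ∘ fun z : R.solenoid => (z : ℕ → UnitAddCircle) n := rfl
    rw [this, ← Measure.map_map (measurable_const_add _) (measurable_coord n), hν]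
    exact map_add_left_eq_self _ _
  exact Measure.isAddHaarMeasure_of_isCompact_nonempty_interior ν Set.univ
    isCompact_univ (by simp) (by simp) (by simp)

end Marginals

/-! ### Eigenfunctions and pure point spectrum. -/

section PurePoint

/-- The continuous eigenfunctions of the flow on the solenoid. -/
def continuousEigenfunctions (hℓ : ∀ n i, R.size n i = ℓ n) : Submonoid C(R.solenoid, ℂ) where
  carrier := {f | ∃ α : ℝ, ∀ z, ‖f z‖ = 1 ∧
    ∀ v : ℝ, f (z + flow hℓ v) = Complex.exp (2 * Real.pi * Complex.I * α * v) * f z}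
  one_mem' := ⟨0, by simp⟩
  mul_mem' := by
    rintro f g ⟨α, hf⟩ ⟨β, hg⟩
    refine ⟨α + β, fun z => ⟨by simp [(hf z).1, (hg z).1], fun v => ?_⟩⟩
    rw [ContinuousMap.mul_apply, (hf z).2, (hg z).2, ContinuousMap.mul_apply]
    push_cast
    rw [mul_add, add_mul, Complex.exp_add]
    ring

theorem star_mem_continuousEigenfunctions (hℓ : ∀ n i, R.size n i = ℓ n) {f : C(R.solenoid, ℂ)}
    (hf : f ∈ continuousEigenfunctions hℓ) : star f ∈ continuousEigenfunctions hℓ := by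
  obtain ⟨α, hf⟩ := hf
  refine ⟨-α, fun z => ⟨by simp [(hf z).1], fun v => ?_⟩⟩
  rw [ContinuousMap.star_apply, (hf z).2, ContinuousMap.star_apply, star_mul, mul_comm]
  congr 1
  rw [Complex.star_def, ← Complex.exp_conj]
  congr 1
  simp only [map_mul, Complex.conj_I, Complex.conj_ofReal, map_ofNat]
  push_cast
  ring

theorem exists_continuousEigenfunction_ne (hℓ : ∀ n i, R.size n i = ℓ n) {z w : R.solenoid}
    (h : z ≠ w) : ∃ f ∈ continuousEigenfunctions hℓ, f z ≠ f w := by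
  obtain ⟨n, hn⟩ : ∃ n, (z : ℕ → UnitAddCircle) n ≠ (w : ℕ → UnitAddCircle) n := by
    by_contra! h'
    exact h (Subtype.ext (funext h'))
  refine ⟨(fourier 1).comp ⟨_, continuous_coord n⟩, ⟨1 / ℓ n, fun z => ⟨?_, fun v => ?_⟩⟩, ?_⟩
  · change ‖fourier 1 ((z : ℕ → UnitAddCircle) n)‖ = 1
    rw [fourier_one, Circle.norm_coe]
  · change fourier 1 ((z : ℕ → UnitAddCircle) n + ((v / ℓ n : ℝ) : UnitAddCircle)) =
      _ * fourier 1 ((z : ℕ → UnitAddCircle) n)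
    rw [fourier_one, fourier_one, AddCircle.toCircle_add, Circle.coe_mul, mul_comm]
    congr 1
    rw [← fourier_one, fourier_coe_apply]
    congr 1
    push_cast
    ring
  · change fourier 1 ((z : ℕ → UnitAddCircle) n) ≠ fourier 1 ((w : ℕ → UnitAddCircle) n)
    rw [fourier_one, fourier_one]
    intro he
    exact hn (AddCircle.injective_toCircle one_ne_zero (Circle.ext he))

/-- Eigenfunctions are closed under products, so their span is the algebra they generate; it is also
closed under conjugation and separates points, as Stone–Weierstrass requires. -/
theorem dense_span_continuousEigenfunctions (hℓ : ∀ n i, R.size n i = ℓ n) :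
    Dense (Submodule.span ℂ (continuousEigenfunctions hℓ : Set C(R.solenoid, ℂ)) :
      Set C(R.solenoid, ℂ)) := by
  let A : StarSubalgebra ℂ C(R.solenoid, ℂ) :=
    { toSubalgebra := Algebra.adjoin ℂ (continuousEigenfunctions hℓ)
      star_mem' := by
        change Algebra.adjoin ℂ (continuousEigenfunctions hℓ : Set C(R.solenoid, ℂ)) ≤
          star (Algebra.adjoin ℂ (continuousEigenfunctions hℓ : Set C(R.solenoid, ℂ)))
        refine Algebra.adjoin_le fun f hf => ?_
        exact Algebra.subset_adjoin (star_mem_continuousEigenfunctions hℓ hf) }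
  have hA : A.SeparatesPoints := by
    intro z w h
    obtain ⟨f, hf, hne⟩ := exists_continuousEigenfunction_ne hℓ h
    exact ⟨f, ⟨f, Algebra.subset_adjoin hf, rfl⟩, hne⟩
  have htop := ContinuousMap.starSubalgebra_topologicalClosure_eq_top_of_separatesPoints A hA
  have hspan : Subalgebra.toSubmodule A.toSubalgebra =
      Submodule.span ℂ (continuousEigenfunctions hℓ : Set C(R.solenoid, ℂ)) := by
    change Subalgebra.toSubmodule (Algebra.adjoin ℂ _) = _
    rw [Algebra.adjoin_eq_span, Submonoid.closure_eq]
  rw [← hspan]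
  change Dense (A : Set C(R.solenoid, ℂ))
  rw [dense_iff_closure_eq, ← StarSubalgebra.topologicalClosure_coe, htop]
  rfl

theorem hasPurePointSpectrum_of_section (hℓ : ∀ n i, R.size n i = ℓ n)
    {μ : Measure (R.TilingSpace 0)} {ν : Measure R.solenoid} [IsProbabilityMeasure ν] [ν.WeaklyRegular]
    {π : R.TilingSpace 0 → R.solenoid} {σ : R.solenoid → R.TilingSpace 0}
    (hflow : ∀ v T, π (T.translate v) = π T + flow hℓ v) (hπ : MeasurePreserving π μ ν)
    (hσ : MeasurePreserving σ ν μ) (hσπ : ∀ᵐ T ∂μ, σ (π T) = T) : HasPurePointSpectrum μ := by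
  let Φ : Lp ℂ 2 ν →ₗᵢ[ℂ] Lp ℂ 2 μ := Lp.compMeasurePreservingₗᵢ ℂ π hπ
  let ι : C(R.solenoid, ℂ) →L[ℂ] Lp ℂ 2 ν := ContinuousMap.toLp 2 ν ℂ
  -- Since `σ ∘ π` is almost everywhere the identity, composing with `σ` gives a preimage.
  have hΦ : Function.Surjective Φ := by
    intro F
    refine ⟨Lp.compMeasurePreserving σ hσ F, Lp.ext ?_⟩
    have h1 : (Φ (Lp.compMeasurePreserving σ hσ F) : R.TilingSpace 0 → ℂ) =ᵐ[μ]
        (Lp.compMeasurePreserving σ hσ F : R.solenoid → ℂ) ∘ π :=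
      Lp.coeFn_compMeasurePreserving _ hπ
    have h2 := hπ.quasiMeasurePreserving.ae_eq_comp (Lp.coeFn_compMeasurePreserving F hσ)
    filter_upwards [h1, h2, hσπ] with T h1 h2 h3
    rw [h1, h2]
    simp [h3]
  have hd : Dense (Φ '' (ι '' (Submodule.span ℂ
      (continuousEigenfunctions hℓ : Set C(R.solenoid, ℂ))))) :=
    hΦ.denseRange.dense_image Φ.continuous
      ((ContinuousMap.toLp_denseRange ℂ ν ℂ (by simp)).dense_image ι.continuous
        (dense_span_continuousEigenfunctions hℓ))
  refine hd.mono ?_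
  rintro _ ⟨_, ⟨f, hf, rfl⟩, rfl⟩
  have hmap : (Φ.toLinearMap ∘ₗ ι.toLinearMap) f ∈ Submodule.map (Φ.toLinearMap ∘ₗ ι.toLinearMap)
      (Submodule.span ℂ (continuousEigenfunctions hℓ : Set C(R.solenoid, ℂ))) :=
    Submodule.mem_map_of_mem hf
  rw [Submodule.map_span] at hmap
  refine Submodule.span_mono ?_ hmap
  rintro _ ⟨f, ⟨α, hf⟩, rfl⟩
  refine ⟨α, f ∘ π, ⟨f.continuous.measurable.comp hπ.measurable, fun T => (hf _).1,
    fun v T => ?_⟩, ?_⟩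
  · rw [Function.comp_apply, hflow, (hf _).2]
    rfl
  · have h1 : (Φ (ι f) : R.TilingSpace 0 → ℂ) =ᵐ[μ] (ι f : R.solenoid → ℂ) ∘ π :=
      Lp.coeFn_compMeasurePreserving _ hπ
    exact h1.trans (hπ.quasiMeasurePreserving.ae_eq_comp (ContinuousMap.coeFn_toLp ν f))

end PurePoint

end FusionRule

end

/-! ### Assembly of the theorem. -/

theorem mainTheorem8 (R : FusionRule) (hne : Nonempty (R.TilingSpace 0))
    (hprim : R.Primitive) (hrec : R.Recognizable) (hreg : R.PrototileRegular)
    (hlen : R.ConstantLength) (hcoin : R.CoincidentWithFiniteWaiting)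
    (hbdd : R.UniformlyBoundedTransitions) :
    R.UniquelyErgodic ∧
      ∀ μ : MeasureTheory.Measure (R.TilingSpace 0), FusionRule.IsInvariantProbability μ →
        FusionRule.HasPurePointSpectrum μ ∧
          ∃ π : R.TilingSpace 0 → R.solenoid, Continuous π ∧ FusionRule.IsSolenoidMap π ∧
            FusionRule.IsMeasurableConjugacy μ π := by
  have hinh : ∀ n, Nonempty (Fin (R.j n)) := by
    obtain ⟨T⟩ := hne
    obtain ⟨t, -⟩ := T.covers 0
    exact fun n => ⟨t.2.cast (hreg n).symm⟩
  obtain ⟨ℓ, hℓ⟩ : ∃ ℓ : ℕ → ℝ, ∀ n i, R.size n i = ℓ n :=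
    ⟨fun n => R.size n (hinh n).some, fun n i => hlen n i _⟩
  have hpos : ∀ n, 0 < ℓ n := fun n => by
    rw [← hℓ n (hinh n).some]; exact R.size_pos n _
  obtain ⟨H, hH, hH'⟩ := hrec.exists_homeomorph
  obtain ⟨π, hπ, hsol, hflow, hcoord⟩ := FusionRule.exists_solenoidMap hℓ H hH hH'
  have hgood := fun r k : ℕ => FusionRule.exists_isOpen_agree hne hℓ hpos hreg hcoin hbdd
    (Nat.cast_nonneg r) (ε := 1 / (k + 1)) Nat.one_div_pos_of_nat
    (by rw [div_le_one (by positivity)]; linarith [Nat.cast_nonneg (α := ℝ) k])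
  choose N E hE hvol hag using hgood
  have hagree : ∀ r k T T', (π T : ℕ → UnitAddCircle) (N r k) ∈ E r k →
      (π T' : ℕ → UnitAddCircle) (N r k) = (π T : ℕ → UnitAddCircle) (N r k) →
      FusionRule.TilingSpace.Agree r T T' := by
    intro r k T T' h1 h2
    rw [hcoord] at h1 h2
    rw [hcoord] at h2
    exact hag r k T T' ((H _).symm T) ((H _).symm T') (by rw [← hH]; simp) (by rw [← hH]; simp)
      h1 h2
  obtain ⟨σ, hσ, hπσ⟩ :=
    FusionRule.exists_measurable_section hne hℓ hpos hπ hflow hE hagree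
  have hGm := FusionRule.measurableSet_determined (R := R) (N := N) hE
  have hinj := FusionRule.injOn_determined hagree
  -- Injectivity of `π` over the determined set turns the right inverse `σ` into a left inverse.
  have hσπ : ∀ T, π T ∈ R.determined N E → σ (π T) = T := fun T hT =>
    hinj (by rw [Set.mem_preimage, hπσ _ hT]; exact hT) hT (hπσ _ hT)
  have hnull : ∀ ν : Measure R.solenoid, IsProbabilityMeasure ν →
      (∀ v, ν.map (· + FusionRule.flow hℓ v) = ν) → ν (R.determined N E)ᶜ = 0 :=
    fun ν _ hν => FusionRule.measure_compl_determined ν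
      (FusionRule.map_coord_eq_volume hℓ hpos ν hν) hE hvol
  set m : Measure R.solenoid := Measure.addHaarMeasure ⊤ with hm
  have hmp : IsProbabilityMeasure m := ⟨by
    simpa using Measure.addHaarMeasure_self
      (K₀ := (⊤ : TopologicalSpace.PositiveCompacts R.solenoid))⟩
  have hmv : ∀ v, m.map (· + FusionRule.flow hℓ v) = m := fun v => map_add_right_eq_self m _
  have hmG := hnull m hmp hmv
  have hmap : ∀ μ : Measure (R.TilingSpace 0), FusionRule.IsInvariantProbability μ →
      MeasurePreserving π μ m ∧ (∀ᵐ T ∂μ, π T ∈ R.determined N E) ∧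
        MeasurePreserving σ m μ := by
    intro μ hμ
    have := hμ.isProbability
    have hp : IsProbabilityMeasure (μ.map π) :=
      Measure.isProbabilityMeasure_map hπ.measurable.aemeasurable
    have hinv : ∀ v, (μ.map π).map (· + FusionRule.flow hℓ v) = μ.map π := by
      intro v
      conv_rhs => rw [← (hμ.invariant v).map_eq]
      rw [Measure.map_map (measurable_add_const _) hπ.measurable,
        Measure.map_map hπ.measurable (hμ.invariant v).measurable]
      congr 1
      funext T
      exact (hflow v T).symm
    have hπm : μ.map π = m := FusionRule.ext_of_map_coord fun n => by
      rw [FusionRule.map_coord_eq_volume hℓ hpos _ hinv,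
        FusionRule.map_coord_eq_volume hℓ hpos _ hmv]
    have hae : ∀ᵐ T ∂μ, π T ∈ R.determined N E := by
      rw [ae_iff]
      have := hnull _ hp hinv
      rwa [Measure.map_apply hπ.measurable hGm.compl] at this
    refine ⟨⟨hπ.measurable, hπm⟩, hae, hσ, ?_⟩
    rw [← hπm, Measure.map_map hσ hπ.measurable]
    have : σ ∘ π =ᵐ[μ] id := hae.mono fun T hT => hσπ T hT
    rw [Measure.map_congr this, Measure.map_id]
  refine ⟨⟨m.map σ, ⟨Measure.isProbabilityMeasure_map hσ.aemeasurable, fun v => ?_⟩,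
    fun μ hμ => (hmap μ hμ).2.2.map_eq.symm⟩, fun μ hμ => ?_⟩
  · have hcont := (FusionRule.TilingSpace.continuous_translate (R := R) (n := 0) v).measurable
    refine ⟨hcont, ?_⟩
    rw [Measure.map_map hcont hσ]
    have hG : ∀ᵐ z ∂m, z ∈ R.determined N E := hmG
    have hG' : ∀ᵐ z ∂m, z + FusionRule.flow hℓ v ∈ R.determined N E :=
      (measurePreserving_add_right m _).quasiMeasurePreserving.ae hG
    -- Equivariance of `σ` is inherited from `π` wherever both `z` and its translate are determined.
    have : FusionRule.TilingSpace.translate v ∘ σ =ᵐ[m] σ ∘ (· + FusionRule.flow hℓ v) := by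
      filter_upwards [hG, hG'] with z hz hz'
      have h1 : π ((σ z).translate v) = z + FusionRule.flow hℓ v := by rw [hflow, hπσ z hz]
      rw [Function.comp_apply, Function.comp_apply, ← h1, hσπ _ (by rwa [h1])]
    rw [Measure.map_congr this, ← Measure.map_map hσ (measurable_add_const _), hmv]
  · obtain ⟨hπμ, hae, hσμ⟩ := hmap μ hμ
    refine ⟨FusionRule.hasPurePointSpectrum_of_section hℓ hflow hπμ hσμ
      (hae.mono fun T hT => hσπ T hT), π, hπ, hsol, hπ.measurable, fun v T n i => ?_, ?_,
      π ⁻¹' R.determined N E, hπ.measurable hGm, hae, hinj⟩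
    · rw [hflow, hℓ]
      rfl
    · rw [hπμ.map_eq]
      exact FusionRule.isAddHaarMeasure_of_map_coord m
        (FusionRule.map_coord_eq_volume hℓ hpos m hmv)
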